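/- Let $n\ge 2$, let $U\subseteq\mathbb R^n$ be open and let $\sigma\colon U\to\mathbb R$ be $C^\infty$. For $(x,y)\in U\times\mathbb R^n$ write $\sigma_0=\sigma_{x^i}y^i$, $\sigma_{00}=\sigma_{x^ix^j}y^iy^j$, $\sigma_{000}=\sigma_{x^ix^jx^k}y^iy^jy^k$. A conical region over an open set $V\subseteq\mathbb R^n$ is an open set $\mathcal C$ of pairs $(x,y)$, $x\in V$, $y\ne 0$, that is closed under $(x,y)\mapsto(x,ty)$ for $t>0$ and has a non-empty fibre over every $x\in V$. Let $\mathcal C$ be a conical region over $U$ on which $\sigma_0\neq 0$ (such a region exists exactly when $d\sigma$ vanishes nowhere on $U$; the largest one is $\{\sigma_0\ne0\}$). Then $$\bar G^i=\frac{\sigma_{00}}{2\sigma_0}\,y^i$$ are the coefficients of a spray on $\mathcal C$ (smooth and positively homogeneous of degree two in $y$), and the following are equivalent: 1. $\bar{\mathbf G}$ is induced by a Finsler metric defined on all of $\mathcal C$; 2. $\bar{\mathbf G}$ is metrizable on $U$: it is induced by a Finsler metric defined on some conical region over $U$ contained in $\mathcal C$; 3. $\bar{\mathbf G}$ is locally metrizable: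 every $x\in U$ has an open neighbourhood $V\subseteq U$ on which $\bar{\mathbf G}$ is metrizable; 4. $\bar{\mathbf G}$ is of zero scalar curvature on $\mathcal C$; 5. $3(\sigma_{00})^2=2\sigma_0\sigma_{000}$ for all $x\in U$, $y\in\mathbb R^n$. Here a Finsler metric on a conical region is a $C^\infty$ function $L(x,y)$ on it, positively homogeneous of degree two in $y$, with $g_{ij}=\frac12L_{y^iy^j}$ non-degenerate (not necessarily definite); it induces the spray $G^i=\frac14g^{il}(L_{x^ky^l}y^k-L_{x^l})$. A spray with Riemann curvature $$R^i{}_k=2\frac{\partial G^i}{\partial x^k}-y^j\frac{\partial^2G^i}{\partial x^j\partial y^k}+2G^j\frac{\partial^2G^i}{\partial y^j\partial y^k}-\frac{\partial G^i}{\partial y^j}\frac{\partial G^j}{\partial y^k}$$ is of scalar curvature if $R^i{}_k=R\,\delta^i_k-\tau_ky^i$ for functions $R,\tau_k$ of $(x,y)$ that are positively homogeneous in $y$ of degrees two and one, and of zero scalar curvature if moreover $R=0$. -/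

import Mathlib

open scoped ContDiff

noncomputable section

namespace SprayGeometry

/-- Coordinates `(x, y)` on the tangent bundle of `ℝⁿ`; functions of `(x, y)` are functions on it. -/
abbrev TSpace (n : ℕ) : Type := (Fin n → ℝ) × (Fin n → ℝ)

variable {n : ℕ}

/-- `∂f/∂xⁱ` for a function `f` of `x` alone. -/
def pd (i : Fin n) (f : (Fin n → ℝ) → ℝ) (x : Fin n → ℝ) : ℝ :=
  fderiv ℝ f x (Pi.single i 1)

/-- `∂f/∂xⁱ` for a function `f` of `(x, y)`. -/
def pdx (i : Fin n) (f : TSpace n → ℝ) (p : TSpace n) : ℝ :=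
  fderiv ℝ f p (Pi.single i 1, 0)

/-- `∂f/∂yⁱ` for a function `f` of `(x, y)`. -/
def pdy (i : Fin n) (f : TSpace n → ℝ) (p : TSpace n) : ℝ :=
  fderiv ℝ f p (0, Pi.single i 1)

/-- `C` is a conical region of `TU ∖ {0}`: an open set of pairs `(x, y)` with `x ∈ U` and `y ≠ 0`,
closed under positive scaling of `y`, with a non-empty fibre over every point of `U`. -/
structure IsConicalRegion (U : Set (Fin n → ℝ)) (C : Set (TSpace n)) : Prop where
  isOpen : IsOpen C
  base_mem : ∀ p ∈ C, p.1 ∈ U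
  ne_zero : ∀ p ∈ C, p.2 ≠ 0
  smul_mem : ∀ p ∈ C, ∀ t : ℝ, 0 < t → (p.1, t • p.2) ∈ C
  fibre_nonempty : ∀ x ∈ U, ∃ y, (x, y) ∈ C

/-- `f` is positively homogeneous of degree `d` in `y` on `C`. -/
def PosHomogeneousOn (C : Set (TSpace n)) (d : ℕ) (f : TSpace n → ℝ) : Prop :=
  ∀ p ∈ C, ∀ t : ℝ, 0 < t → f (p.1, t • p.2) = t ^ d * f p

/-- `Gⁱ` are the coefficients of a spray `yⁱ ∂/∂xⁱ - 2 Gⁱ ∂/∂yⁱ` on `C`. -/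
structure IsSprayOn (C : Set (TSpace n)) (G : Fin n → TSpace n → ℝ) : Prop where
  smooth : ∀ i, ContDiffOn ℝ ∞ (G i) C
  homogeneous : ∀ i, PosHomogeneousOn C 2 (G i)

/-- The Riemann curvature
`Rⁱₖ = 2 ∂ₖGⁱ - yʲ ∂ⱼ∂̇ₖGⁱ + 2 Gʲ ∂̇ⱼ∂̇ₖGⁱ - (∂̇ⱼGⁱ)(∂̇ₖGʲ)`. -/
def riemannCurvature (G : Fin n → TSpace n → ℝ) (i k : Fin n) (p : TSpace n) : ℝ :=
  2 * pdx k (G i) p - ∑ j, p.2 j * pdx j (pdy k (G i)) p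
    + 2 * ∑ j, G j p * pdy j (pdy k (G i)) p - ∑ j, pdy j (G i) p * pdy k (G j) p

/-- `G` is of scalar curvature on `C` with scalar `R`: `Rⁱₖ = R δⁱₖ - τₖ yⁱ` for homogeneous
functions `R` (degree two) and `τₖ` (degree one). For `n ≥ 2` this determines `R`. -/
def HasScalarCurvature (C : Set (TSpace n)) (G : Fin n → TSpace n → ℝ) (R : TSpace n → ℝ) : Prop :=
  PosHomogeneousOn C 2 R ∧
    ∃ τ : Fin n → TSpace n → ℝ, (∀ k, PosHomogeneousOn C 1 (τ k)) ∧
      ∀ p ∈ C, ∀ i k, riemannCurvature G i k p = (if i = k then R p else 0) - τ k p * p.2 i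

/-- `G` is of zero scalar curvature on `C`: it is of scalar curvature and the scalar vanishes. -/
def IsOfZeroScalarCurvature (C : Set (TSpace n)) (G : Fin n → TSpace n → ℝ) : Prop :=
  ∃ R : TSpace n → ℝ, HasScalarCurvature C G R ∧ ∀ p ∈ C, R p = 0

/-- The fundamental tensor `gᵢⱼ = (L/2)_{yⁱyʲ}`. -/
def fundamentalTensor (L : TSpace n → ℝ) (p : TSpace n) : Matrix (Fin n) (Fin n) ℝ :=
  Matrix.of fun i j => pdy j (pdy i (fun q => L q / 2)) p

/-- `L` is a (possibly singular) Finsler metric on `C`: smooth, positively homogeneous of degree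
two, with non-degenerate fundamental tensor (so `L` vanishes identically on no open set
when `n ≥ 1`). -/
structure IsFinslerMetricOn (C : Set (TSpace n)) (L : TSpace n → ℝ) : Prop where
  smooth : ContDiffOn ℝ ∞ L C
  homogeneous : PosHomogeneousOn C 2 L
  nondegenerate : ∀ p ∈ C, (fundamentalTensor L p).det ≠ 0

/-- The spray coefficients `Gⁱ = (1/4) gⁱˡ (L_{xᵏyˡ} yᵏ - L_{xˡ})` of a Finsler metric. -/
def inducedSpray (L : TSpace n → ℝ) (i : Fin n) (p : TSpace n) : ℝ :=
  1 / 4 * ∑ l, (fundamentalTensor L p)⁻¹ i l * (∑ k, pdx k (pdy l L) p * p.2 k - pdx l L p)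

/-- Some Finsler metric on the whole of `C` induces `G` on `C`. -/
def IsInducedOn (C : Set (TSpace n)) (G : Fin n → TSpace n → ℝ) : Prop :=
  ∃ L : TSpace n → ℝ, IsFinslerMetricOn C L ∧ ∀ p ∈ C, ∀ i, G i p = inducedSpray L i p

/-- The spray `G` on the conical region `C` is (globally) Finsler-metrizable on `U`: it is induced
by a Finsler metric defined on some conical region over `U` contained in `C`. -/
def IsMetrizable (U : Set (Fin n → ℝ)) (C : Set (TSpace n)) (G : Fin n → TSpace n → ℝ) : Prop :=
  ∃ C' ⊆ C, IsConicalRegion U C' ∧ IsInducedOn C' G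

/-- The spray `G` on `C` is locally Finsler-metrizable on `U`. -/
def IsLocallyMetrizable (U : Set (Fin n → ℝ)) (C : Set (TSpace n))
    (G : Fin n → TSpace n → ℝ) : Prop :=
  ∀ x ∈ U, ∃ V ⊆ U, IsOpen V ∧ x ∈ V ∧ IsMetrizable V C G

/-- `σ₀ = σᵢ yⁱ`. -/
def sigma1 (σ : (Fin n → ℝ) → ℝ) (p : TSpace n) : ℝ :=
  ∑ i, pd i σ p.1 * p.2 i

/-- `σ₀₀ = σᵢⱼ yⁱ yʲ`. -/
def sigma2 (σ : (Fin n → ℝ) → ℝ) (p : TSpace n) : ℝ :=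
  ∑ i, ∑ j, pd j (pd i σ) p.1 * p.2 i * p.2 j

/-- `σ₀₀₀ = σᵢⱼₖ yⁱ yʲ yᵏ`. -/
def sigma3 (σ : (Fin n → ℝ) → ℝ) (p : TSpace n) : ℝ :=
  ∑ i, ∑ j, ∑ k, pd k (pd j (pd i σ)) p.1 * p.2 i * p.2 j * p.2 k

/-- The coefficients `Ḡⁱ = (σ₀₀ / (2 σ₀)) yⁱ`. -/
def sigmaSpray (σ : (Fin n → ℝ) → ℝ) (i : Fin n) (p : TSpace n) : ℝ :=
  sigma2 σ p / (2 * sigma1 σ p) * p.2 i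

end SprayGeometry

end

/-! Write `P = σ₀₀ / (2σ₀)`, so the spray is `P yⁱ`. Everything is compared with the equation
`P_{xᵏ} yᵏ = P²`: where `σ₀ ≠ 0` it is the condition on `σ` (`sigma_condition_eq`), and `P² - P_{xᵏ}
yᵏ` is the coefficient of `δⁱₖ` in the Riemann curvature (`riemannCurvature_sigmaSpray`). Being
polynomial in `y`, the condition passes from an open cone to all `y`.

Metrizability forces the equation. A metric `L` inducing the spray satisfies `L_{xᵃ} = P L_{yᵃ} + 2
P_{yᵃ} L`, while `σ₀` always satisfies the degree-one analogue. Hence `H = L / σ₀²` is homogeneous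
of degree zero with `H_{xᵃ} = P H_{yᵃ}`, and equality of mixed derivatives gives `(P_{xᵏ} yᵏ - P²)
H_{yᵃ} = 0`. If the first factor were non-zero at a point, `H` would be independent of `y` nearby
and `gᵢⱼ = H σᵢ σⱼ` would be degenerate, since `n ≥ 2` (`fderiv_projFactor_of_induced`).

Conversely, the condition makes `σ₀₀` vanish on the kernel of `dσ`, so `σᵢⱼ = pᵢ σⱼ + pⱼ σᵢ` and `P
= pᵢ yⁱ` is linear in `y` (`hessian_eq`). The condition together with symmetry of third derivatives
gives `∂ₖ pᵢ = pᵢ pₖ` (`fderiv_projForm`), so on each component of `U` one has `p = ℓ / B` with `B =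
1 - ℓ (x - x₀)` affine and nowhere zero (`affineDenom_smul_eq`). The Euclidean metric pulled back by
the projective map `(x - x₀) / B` then induces the spray, on all of `C` at once. -/

noncomputable section

namespace SprayGeometry

open Filter Topology

/-! ### Second derivatives of smooth maps -/

section Calculus

variable {X Y : Type*} [NormedAddCommGroup X] [NormedSpace ℝ X]
  [NormedAddCommGroup Y] [NormedSpace ℝ Y]

theorem contDiffAt_fderiv {f : X → Y} {p : X} (hf : ContDiffAt ℝ ∞ f p) :
    ContDiffAt ℝ ∞ (fderiv ℝ f) p :=
  hf.fderiv_right (m := ∞) (by simp)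

theorem differentiableAt_of_smooth {f : X → Y} {p : X} (hf : ContDiffAt ℝ ∞ f p) :
    DifferentiableAt ℝ f p :=
  hf.differentiableAt (by simp)

theorem fderiv_fderiv_apply_field {f : X → Y} {p : X} (hf : ContDiffAt ℝ ∞ f p) {u : X → X}
    {u' : X →L[ℝ] X} (hu : HasFDerivAt u u' p) (b : X) :
    fderiv ℝ (fun q => fderiv ℝ f q (u q)) p b =
      fderiv ℝ (fderiv ℝ f) p b (u p) + fderiv ℝ f p (u' b) := by
  have h := (differentiableAt_of_smooth (contDiffAt_fderiv hf)).hasFDerivAt.clm_apply hu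
  rw [h.fderiv]
  simp [add_comm]

theorem fderiv_fderiv_apply_const {f : X → Y} {p : X} (hf : ContDiffAt ℝ ∞ f p) (a b : X) :
    fderiv ℝ (fun q => fderiv ℝ f q a) p b = fderiv ℝ (fderiv ℝ f) p b a := by
  simpa using fderiv_fderiv_apply_field hf (hasFDerivAt_const a p) b

theorem fderiv_fderiv_comm {f : X → Y} {p : X} (hf : ContDiffAt ℝ ∞ f p) (a b : X) :
    fderiv ℝ (fderiv ℝ f) p a b = fderiv ℝ (fderiv ℝ f) p b a :=
  (hf.isSymmSndFDerivAt (by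
    rw [minSmoothness_of_isRCLikeNormedField]
    exact WithTop.coe_le_coe.2 (le_top : (2 : ℕ∞) ≤ ⊤))).eq a b

end Calculus

/-! ### The contractions of `σ` as iterated Fréchet derivatives -/

section SigmaDerivatives

variable {n : ℕ}

theorem apply_eq_sum_single (ℓ : (Fin n → ℝ) →L[ℝ] ℝ) (y : Fin n → ℝ) :
    ℓ y = ∑ i, ℓ (Pi.single i 1) * y i := by
  conv_lhs => rw [pi_eq_sum_univ' y, map_sum]
  refine Finset.sum_congr rfl fun i _ => ?_
  rw [map_smul, smul_eq_mul, mul_comm]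

theorem sigma1_eq (σ : (Fin n → ℝ) → ℝ) (p : TSpace n) :
    sigma1 σ p = fderiv ℝ σ p.1 p.2 :=
  (apply_eq_sum_single _ _).symm

variable {U : Set (Fin n → ℝ)} {σ : (Fin n → ℝ) → ℝ}

theorem contDiffAt_of_mem (hU : IsOpen U) (hσ : ContDiffOn ℝ ∞ σ U) {x : Fin n → ℝ} (hx : x ∈ U) :
    ContDiffAt ℝ ∞ σ x :=
  hσ.contDiffAt (hU.mem_nhds hx)

theorem pd_pd_eq (hU : IsOpen U) (hσ : ContDiffOn ℝ ∞ σ U) {x : Fin n → ℝ} (hx : x ∈ U)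
    (i j : Fin n) : pd j (pd i σ) x =
      fderiv ℝ (fderiv ℝ σ) x (Pi.single j 1) (Pi.single i 1) :=
  fderiv_fderiv_apply_const (contDiffAt_of_mem hU hσ hx) _ _

theorem pd_pd_pd_eq (hU : IsOpen U) (hσ : ContDiffOn ℝ ∞ σ U) {x : Fin n → ℝ} (hx : x ∈ U)
    (i j k : Fin n) : pd k (pd j (pd i σ)) x =
      fderiv ℝ (fderiv ℝ (fderiv ℝ σ)) x (Pi.single k 1) (Pi.single j 1) (Pi.single i 1) := by
  have h : pd j (pd i σ) =ᶠ[𝓝 x]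
      fun z => fderiv ℝ (fderiv ℝ σ) z (Pi.single j 1) (Pi.single i 1) := by
    filter_upwards [hU.mem_nhds hx] with z hz using pd_pd_eq hU hσ hz i j
  have h2 := contDiffAt_fderiv (contDiffAt_of_mem hU hσ hx)
  have h3 := differentiableAt_of_smooth (contDiffAt_fderiv h2)
  unfold pd at h ⊢
  rw [h.fderiv_eq, ((h3.hasFDerivAt.clm_apply (hasFDerivAt_const _ x)).clm_apply
    (hasFDerivAt_const _ x)).fderiv]
  simp

theorem sigma2_eq (hU : IsOpen U) (hσ : ContDiffOn ℝ ∞ σ U) {p : TSpace n} (hp : p.1 ∈ U) :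
    sigma2 σ p = fderiv ℝ (fderiv ℝ σ) p.1 p.2 p.2 := by
  have h2 := contDiffAt_of_mem hU hσ hp
  rw [apply_eq_sum_single (fderiv ℝ (fderiv ℝ σ) p.1 p.2), sigma2]
  refine Finset.sum_congr rfl fun i _ => ?_
  rw [fderiv_fderiv_comm h2, apply_eq_sum_single (fderiv ℝ (fderiv ℝ σ) p.1 _), Finset.sum_mul]
  refine Finset.sum_congr rfl fun j _ => ?_
  rw [pd_pd_eq hU hσ hp, fderiv_fderiv_comm h2]
  ring

theorem fderiv3_comm_left (hU : IsOpen U) (hσ : ContDiffOn ℝ ∞ σ U) {x : Fin n → ℝ} (hx : x ∈ U)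
    (a b c : Fin n → ℝ) : fderiv ℝ (fderiv ℝ (fderiv ℝ σ)) x a b c =
      fderiv ℝ (fderiv ℝ (fderiv ℝ σ)) x b a c := by
  rw [fderiv_fderiv_comm (contDiffAt_fderiv (contDiffAt_of_mem hU hσ hx))]

theorem fderiv3_apply (hU : IsOpen U) (hσ : ContDiffOn ℝ ∞ σ U) {x : Fin n → ℝ} (hx : x ∈ U)
    (a b c : Fin n → ℝ) : fderiv ℝ (fun z => fderiv ℝ (fderiv ℝ σ) z b c) x a =
      fderiv ℝ (fderiv ℝ (fderiv ℝ σ)) x a b c := by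
  have h2 := contDiffAt_fderiv (contDiffAt_of_mem hU hσ hx)
  have h3 := differentiableAt_of_smooth (contDiffAt_fderiv h2)
  rw [((h3.hasFDerivAt.clm_apply (hasFDerivAt_const _ x)).clm_apply
    (hasFDerivAt_const _ x)).fderiv]
  simp

/-- The Hessian is symmetric at every point near `x`, and this identity may be differentiated. -/
theorem fderiv3_comm_right (hU : IsOpen U) (hσ : ContDiffOn ℝ ∞ σ U) {x : Fin n → ℝ} (hx : x ∈ U)
    (a b c : Fin n → ℝ) : fderiv ℝ (fderiv ℝ (fderiv ℝ σ)) x a b c =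
      fderiv ℝ (fderiv ℝ (fderiv ℝ σ)) x a c b := by
  rw [← fderiv3_apply hU hσ hx, ← fderiv3_apply hU hσ hx]
  congr 1
  refine Filter.EventuallyEq.fderiv_eq ?_
  filter_upwards [hU.mem_nhds hx] with z hz
  exact fderiv_fderiv_comm (contDiffAt_of_mem hU hσ hz) _ _

theorem sigma3_eq (hU : IsOpen U) (hσ : ContDiffOn ℝ ∞ σ U) {p : TSpace n} (hp : p.1 ∈ U) :
    sigma3 σ p = fderiv ℝ (fderiv ℝ (fderiv ℝ σ)) p.1 p.2 p.2 p.2 := by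
  set T := fderiv ℝ (fderiv ℝ (fderiv ℝ σ)) p.1 with hT
  have hl : ∀ a b c, T a b c = T b a c := fderiv3_comm_left hU hσ hp
  have hr : ∀ a b c, T a b c = T a c b := fderiv3_comm_right hU hσ hp
  rw [apply_eq_sum_single (T p.2 p.2), sigma3]
  refine Finset.sum_congr rfl fun i _ => ?_
  rw [hr, apply_eq_sum_single (T p.2 _), Finset.sum_mul]
  refine Finset.sum_congr rfl fun j _ => ?_
  rw [hl, hr, apply_eq_sum_single (T _ _), Finset.sum_mul, Finset.sum_mul]
  refine Finset.sum_congr rfl fun k _ => ?_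
  rw [pd_pd_pd_eq hU hσ hp, ← hT, hr (Pi.single k 1), hl (Pi.single k 1), hr (Pi.single i 1)]
  ring

theorem hasFDerivAt_sigma1 (hU : IsOpen U) (hσ : ContDiffOn ℝ ∞ σ U) {p : TSpace n}
    (hp : p.1 ∈ U) : ContDiffAt ℝ ∞ (sigma1 σ) p ∧ ∀ b, fderiv ℝ (sigma1 σ) p b =
      fderiv ℝ (fderiv ℝ σ) p.1 b.1 p.2 + fderiv ℝ σ p.1 b.2 := by
  have h1 := contDiffAt_fderiv (contDiffAt_of_mem hU hσ hp)
  have he : sigma1 σ = fun q : TSpace n => fderiv ℝ σ q.1 q.2 := funext (sigma1_eq σ)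
  rw [he]
  have hc : ContDiffAt ℝ ∞ (fun q : TSpace n => fderiv ℝ σ q.1) p :=
    h1.comp p (f := Prod.fst) contDiffAt_fst
  refine ⟨hc.clm_apply contDiffAt_snd, fun b => ?_⟩
  have hd : HasFDerivAt (fun q : TSpace n => fderiv ℝ σ q.1) _ p :=
    (differentiableAt_of_smooth h1).hasFDerivAt.comp p (f := Prod.fst) hasFDerivAt_fst
  rw [(hd.clm_apply hasFDerivAt_snd).fderiv]
  simp [add_comm]

theorem hasFDerivAt_sigma2 (hU : IsOpen U) (hσ : ContDiffOn ℝ ∞ σ U) {p : TSpace n}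
    (hp : p.1 ∈ U) : ContDiffAt ℝ ∞ (sigma2 σ) p ∧ ∀ b, fderiv ℝ (sigma2 σ) p b =
      fderiv ℝ (fderiv ℝ (fderiv ℝ σ)) p.1 b.1 p.2 p.2 +
        2 * fderiv ℝ (fderiv ℝ σ) p.1 b.2 p.2 := by
  have h0 := contDiffAt_of_mem hU hσ hp
  have h2 := contDiffAt_fderiv (contDiffAt_fderiv h0)
  have he : sigma2 σ =ᶠ[𝓝 p] fun q : TSpace n => fderiv ℝ (fderiv ℝ σ) q.1 q.2 q.2 := by
    filter_upwards [continuousAt_fst.preimage_mem_nhds (hU.mem_nhds hp)] with q hq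
    exact sigma2_eq hU hσ hq
  have hc : ContDiffAt ℝ ∞ (fun q : TSpace n => fderiv ℝ (fderiv ℝ σ) q.1) p :=
    h2.comp p (f := Prod.fst) contDiffAt_fst
  refine ⟨((hc.clm_apply contDiffAt_snd).clm_apply contDiffAt_snd).congr_of_eventuallyEq he,
    fun b => ?_⟩
  have hd : HasFDerivAt (fun q : TSpace n => fderiv ℝ (fderiv ℝ σ) q.1) _ p :=
    (differentiableAt_of_smooth h2).hasFDerivAt.comp p (f := Prod.fst) hasFDerivAt_fst
  rw [he.fderiv_eq, ((hd.clm_apply hasFDerivAt_snd).clm_apply hasFDerivAt_snd).fderiv]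
  simp
  rw [fderiv_fderiv_comm h0 p.2 b.2]
  ring

end SigmaDerivatives

/-! ### When a Finsler metric induces a spray `P yⁱ` -/

section MetricCriterion

variable {n : ℕ}

theorem PosHomogeneousOn.euler {C : Set (TSpace n)} {d : ℕ} {f : TSpace n → ℝ}
    (hf : PosHomogeneousOn C d f) {p : TSpace n} (hp : p ∈ C) (hd : DifferentiableAt ℝ f p) :
    fderiv ℝ f p (0, p.2) = d * f p := by
  have h1 : HasDerivAt (fun t : ℝ => ((p.1, t • p.2) : TSpace n)) (0, p.2) 1 := by
    simpa using (hasDerivAt_const (1 : ℝ) p.1).prodMk ((hasDerivAt_id (1 : ℝ)).smul_const p.2)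
  have hd' : HasFDerivAt f (fderiv ℝ f p) ((p.1, (1 : ℝ) • p.2) : TSpace n) := by
    simpa using hd.hasFDerivAt
  have h2 := hd'.comp_hasDerivAt (1 : ℝ) h1
  have h3 : HasDerivAt (fun t : ℝ => t ^ d * f p) (d * f p) 1 := by
    simpa using (hasDerivAt_pow d (1 : ℝ)).mul_const (f p)
  refine h2.unique (h3.congr_of_eventuallyEq ?_)
  filter_upwards [lt_mem_nhds (zero_lt_one (α := ℝ))] with t ht
  exact hf p hp t ht

theorem hasFDerivAt_vertical (p : TSpace n) : HasFDerivAt (fun q : TSpace n => ((0, q.2) : TSpace n))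
    ((0 : TSpace n →L[ℝ] (Fin n → ℝ)).prod (ContinuousLinearMap.snd ℝ _ _)) p :=
  (hasFDerivAt_const _ _).prodMk hasFDerivAt_snd

theorem hasFDerivAt_horizontal (p : TSpace n) :
    HasFDerivAt (fun q : TSpace n => ((q.2, 0) : TSpace n))
      ((ContinuousLinearMap.snd ℝ _ _).prod (0 : TSpace n →L[ℝ] (Fin n → ℝ))) p :=
  hasFDerivAt_snd.prodMk (hasFDerivAt_const _ _)

theorem apply_inl_eq_sum (ℓ : TSpace n →L[ℝ] ℝ) (y : Fin n → ℝ) :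
    ℓ (y, 0) = ∑ i, ℓ (Pi.single i 1, 0) * y i := by
  simpa using apply_eq_sum_single (ℓ.comp (ContinuousLinearMap.inl ℝ _ _)) y

theorem apply_inr_eq_sum (ℓ : TSpace n →L[ℝ] ℝ) (y : Fin n → ℝ) :
    ℓ (0, y) = ∑ i, ℓ (0, Pi.single i 1) * y i := by
  simpa using apply_eq_sum_single (ℓ.comp (ContinuousLinearMap.inr ℝ _ _)) y

variable {C : Set (TSpace n)} {L : TSpace n → ℝ}

/-- Euler's identity `L_{yⁱ} yⁱ = 2L`, differentiated in the direction `b`. -/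
theorem PosHomogeneousOn.fderiv_fderiv_vertical (hC : IsOpen C) (hL : ContDiffOn ℝ ∞ L C)
    (hh : PosHomogeneousOn C 2 L) {p : TSpace n} (hp : p ∈ C) (b : TSpace n) :
    fderiv ℝ (fderiv ℝ L) p b (0, p.2) = 2 * fderiv ℝ L p b - fderiv ℝ L p (0, b.2) := by
  have hs := hL.contDiffAt (hC.mem_nhds hp)
  have he : (fun q => fderiv ℝ L q (0, q.2)) =ᶠ[𝓝 p] fun q => 2 * L q := by
    filter_upwards [hC.mem_nhds hp] with q hq
    simpa using hh.euler hq (differentiableAt_of_smooth (hL.contDiffAt (hC.mem_nhds hq)))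
  have h1 := fderiv_fderiv_apply_field hs (hasFDerivAt_vertical p) b
  rw [he.fderiv_eq, fderiv_const_mul (differentiableAt_of_smooth hs)] at h1
  simp at h1
  linarith

theorem fundamentalTensor_apply {p : TSpace n} (hs : ContDiffAt ℝ ∞ L p) (i j : Fin n) :
    fundamentalTensor L p i j =
      fderiv ℝ (fderiv ℝ L) p (0, Pi.single j 1) (0, Pi.single i 1) / 2 := by
  have he : pdy i (fun q => L q / 2) =
      (2 : ℝ)⁻¹ • fun q => fderiv ℝ L q (0, Pi.single i 1) := by
    funext q
    have : (fun q => L q / 2) = (2 : ℝ)⁻¹ • L := by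
      funext q
      simp only [Pi.smul_apply, smul_eq_mul]
      ring
    rw [pdy, this, fderiv_const_smul_field]
    simp
  simp only [fundamentalTensor, Matrix.of_apply]
  rw [he, pdy, fderiv_const_smul_field]
  simp only [smul_apply, Pi.smul_apply, smul_eq_mul]
  rw [fderiv_fderiv_apply_const hs]
  ring

theorem fundamentalTensor_mulVec {p : TSpace n} (hs : ContDiffAt ℝ ∞ L p) (w : Fin n → ℝ)
    (i : Fin n) : (fundamentalTensor L p).mulVec w i =
      fderiv ℝ (fderiv ℝ L) p (0, Pi.single i 1) (0, w) / 2 := by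
  simp only [Matrix.mulVec, dotProduct]
  rw [apply_inr_eq_sum (fderiv ℝ (fderiv ℝ L) p _), Finset.sum_div]
  refine Finset.sum_congr rfl fun j _ => ?_
  rw [fundamentalTensor_apply hs, fderiv_fderiv_comm hs]
  ring

/-- Multiplying `4P y = g⁻¹ c` by `g` removes the inverse matrix, because homogeneity gives `gᵢⱼ yʲ
= L_{yⁱ} / 2`. -/
theorem projective_eq_inducedSpray_iff (hC : IsOpen C) (hL : IsFinslerMetricOn C L)
    {p : TSpace n} (hp : p ∈ C) (P : ℝ) :
    (∀ i, P * p.2 i = inducedSpray L i p) ↔ ∀ a, fderiv ℝ (fderiv ℝ L) p (p.2, 0) (0, a) -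
      fderiv ℝ L p (a, 0) = 2 * P * fderiv ℝ L p (0, a) := by
  have hs := hL.smooth.contDiffAt (hC.mem_nhds hp)
  have hdet : IsUnit (fundamentalTensor L p).det := (hL.nondegenerate p hp).isUnit
  set c : Fin n → ℝ := fun l => fderiv ℝ (fderiv ℝ L) p (p.2, 0) (0, Pi.single l 1) -
      fderiv ℝ L p (Pi.single l 1, 0) with hc
  have h1 : ∀ i, inducedSpray L i p = 1 / 4 * ((fundamentalTensor L p)⁻¹.mulVec c) i := by
    intro i
    simp only [inducedSpray, Matrix.mulVec, dotProduct]
    congr 1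
    refine Finset.sum_congr rfl fun l _ => ?_
    congr 2
    rw [fderiv_fderiv_comm hs, apply_inl_eq_sum]
    refine Finset.sum_congr rfl fun k _ => ?_
    rw [pdx, fderiv_fderiv_comm hs]
    congr 1
    exact fderiv_fderiv_apply_const hs _ _
  have h2 : ∀ l, (fundamentalTensor L p).mulVec p.2 l = fderiv ℝ L p (0, Pi.single l 1) / 2 := by
    intro l
    rw [fundamentalTensor_mulVec hs,
      PosHomogeneousOn.fderiv_fderiv_vertical hC hL.smooth hL.homogeneous hp]
    ring
  have h3 : (∀ i, P * p.2 i = inducedSpray L i p) ↔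
      (4 * P) • p.2 = (fundamentalTensor L p)⁻¹.mulVec c := by
    rw [funext_iff]
    refine forall_congr' fun i => ?_
    rw [h1, Pi.smul_apply, smul_eq_mul]
    constructor <;> intro h <;> linarith
  have h4 : (4 * P) • p.2 = (fundamentalTensor L p)⁻¹.mulVec c ↔
      (fundamentalTensor L p).mulVec ((4 * P) • p.2) = c := by
    constructor
    · intro h
      rw [h, Matrix.mulVec_mulVec, Matrix.mul_nonsing_inv _ hdet, Matrix.one_mulVec]
    · intro h
      rw [← h, Matrix.mulVec_mulVec, Matrix.nonsing_inv_mul _ hdet, Matrix.one_mulVec]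
  rw [h3, h4, Matrix.mulVec_smul]
  constructor
  · intro h a
    have hl : ∀ l, c l = 2 * P * fderiv ℝ L p (0, Pi.single l 1) := by
      intro l
      rw [← h, Pi.smul_apply, h2, smul_eq_mul]
      ring
    rw [apply_inr_eq_sum, apply_inl_eq_sum, apply_inr_eq_sum (fderiv ℝ L p), Finset.mul_sum,
      ← Finset.sum_sub_distrib]
    refine Finset.sum_congr rfl fun l _ => ?_
    rw [← mul_assoc, ← hl, hc]
    ring
  · intro h
    funext l
    rw [Pi.smul_apply, h2, smul_eq_mul, hc]
    simp only [h]
    ring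

/-- A Finsler metric `L` induces the projectively flat spray `P yⁱ` exactly when `L` is parallel
along its horizontal distribution. -/
theorem forall_projective_eq_inducedSpray_iff (hC : IsOpen C) (hL : IsFinslerMetricOn C L)
    {P : TSpace n → ℝ} (hP : ∀ p ∈ C, DifferentiableAt ℝ P p)
    (hP1 : ∀ p ∈ C, fderiv ℝ P p (0, p.2) = P p) :
    (∀ p ∈ C, ∀ i, P p * p.2 i = inducedSpray L i p) ↔ ∀ p ∈ C, ∀ a, fderiv ℝ L p (a, 0) =
      P p * fderiv ℝ L p (0, a) + 2 * fderiv ℝ P p (0, a) * L p := by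
  have hs : ∀ p ∈ C, ContDiffAt ℝ ∞ L p := fun p hp => hL.smooth.contDiffAt (hC.mem_nhds hp)
  have hE : ∀ p ∈ C, fderiv ℝ L p (0, p.2) = 2 * L p := fun p hp => by
    simpa using hL.homogeneous.euler hp (differentiableAt_of_smooth (hs p hp))
  have hV : ∀ p ∈ C, ∀ b, fderiv ℝ (fderiv ℝ L) p b (0, p.2) = _ := fun p hp b =>
    PosHomogeneousOn.fderiv_fderiv_vertical hC hL.smooth hL.homogeneous hp b
  -- The `yᵃ`-derivative of `L_{xᵏ} yᵏ = 4PL`. Adding or subtracting it turns either side of the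
  -- criterion into the other.
  have key : (∀ p ∈ C, fderiv ℝ L p (p.2, 0) = 4 * (P p * L p)) → ∀ p ∈ C, ∀ a,
      fderiv ℝ (fderiv ℝ L) p (p.2, 0) (0, a) + fderiv ℝ L p (a, 0) =
        4 * (P p * fderiv ℝ L p (0, a) + L p * fderiv ℝ P p (0, a)) := by
    intro h p hp a
    have he : (fun q => fderiv ℝ L q (q.2, 0)) =ᶠ[𝓝 p] fun q => 4 * (P q * L q) := by
      filter_upwards [hC.mem_nhds hp] with q hq using h q hq
    have h1 := fderiv_fderiv_apply_field (hs p hp) (hasFDerivAt_horizontal p) (0, a)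
    have h2 : HasFDerivAt (fun q => 4 * (P q * L q)) _ p := ((hP p hp).hasFDerivAt.mul
      (differentiableAt_of_smooth (hs p hp)).hasFDerivAt).const_mul 4
    rw [he.fderiv_eq, h2.fderiv, fderiv_fderiv_comm (hs p hp)] at h1
    simp at h1
    linarith
  trans ∀ p ∈ C, ∀ a, fderiv ℝ (fderiv ℝ L) p (p.2, 0) (0, a) - fderiv ℝ L p (a, 0) =
      2 * P p * fderiv ℝ L p (0, a)
  · exact forall₂_congr fun p hp => projective_eq_inducedSpray_iff hC hL hp (P p)
  constructor
  · intro h p hp a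
    -- Contraction with `y`: the choice `a = y`, simplified by the Euler identities.
    have h0 : ∀ p ∈ C, fderiv ℝ L p (p.2, 0) = 4 * (P p * L p) := by
      intro p hp
      have h1 := h p hp p.2
      rw [hV p hp, hE p hp] at h1
      simp only [Prod.mk_zero_zero, map_zero] at h1
      linarith
    linarith [key h0 p hp a, h p hp a]
  · intro h p hp a
    have h0 : ∀ p ∈ C, fderiv ℝ L p (p.2, 0) = 4 * (P p * L p) := by
      intro p hp
      rw [h p hp, hE p hp, hP1 p hp]
      ring
    linarith [key h0 p hp a, h p hp a]

end MetricCriterion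

/-! ### The factor `P` and the obstruction to metrizability -/

section ProjectiveFactor

variable {n : ℕ}

/-- The projective factor `σ₀₀ / (2 σ₀)`. -/
def projFactor (σ : (Fin n → ℝ) → ℝ) (p : TSpace n) : ℝ :=
  sigma2 σ p / (2 * sigma1 σ p)

theorem sigmaSpray_eq (σ : (Fin n → ℝ) → ℝ) (i : Fin n) (p : TSpace n) :
    sigmaSpray σ i p = projFactor σ p * p.2 i := rfl

variable {U : Set (Fin n → ℝ)} {σ : (Fin n → ℝ) → ℝ}

theorem contDiffAt_projFactor (hU : IsOpen U) (hσ : ContDiffOn ℝ ∞ σ U) {p : TSpace n}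
    (hp : p.1 ∈ U) (h0 : sigma1 σ p ≠ 0) : ContDiffAt ℝ ∞ (projFactor σ) p :=
  (hasFDerivAt_sigma2 hU hσ hp).1.div (contDiffAt_const.mul (hasFDerivAt_sigma1 hU hσ hp).1)
    (mul_ne_zero two_ne_zero h0)

theorem projFactor_mul {p : TSpace n} (h0 : sigma1 σ p ≠ 0) :
    2 * (projFactor σ p * sigma1 σ p) = sigma2 σ p := by
  unfold projFactor
  field_simp

theorem fderiv_projFactor (hU : IsOpen U) (hσ : ContDiffOn ℝ ∞ σ U) {p : TSpace n}
    (hp : p.1 ∈ U) (h0 : sigma1 σ p ≠ 0) (b : TSpace n) :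
    2 * (fderiv ℝ (projFactor σ) p b * sigma1 σ p +
      projFactor σ p * fderiv ℝ (sigma1 σ) p b) = fderiv ℝ (sigma2 σ) p b := by
  have hF := (hasFDerivAt_sigma1 hU hσ hp).1
  have he : sigma2 σ =ᶠ[𝓝 p] fun q => 2 * (projFactor σ q * sigma1 σ q) := by
    filter_upwards [hF.continuousAt.eventually_ne h0] with q hq using (projFactor_mul hq).symm
  have h2 : HasFDerivAt (fun q => 2 * (projFactor σ q * sigma1 σ q)) _ p :=
    ((differentiableAt_of_smooth (contDiffAt_projFactor hU hσ hp h0)).hasFDerivAt.mul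
      (differentiableAt_of_smooth hF).hasFDerivAt).const_mul 2
  rw [he.fderiv_eq, h2.fderiv]
  simp
  ring

/-- The `yᵃ`-derivative of `2Pσ₀ = σ₀₀`, whose right side becomes `2 σₐₖ yᵏ = 2 ∂σ₀/∂xᵃ`. Thus `σ₀`
obeys, in degree one, the transport law that an inducing metric obeys in degree two. -/
theorem fderiv_sigma1_horizontal (hU : IsOpen U) (hσ : ContDiffOn ℝ ∞ σ U) {p : TSpace n}
    (hp : p.1 ∈ U) (h0 : sigma1 σ p ≠ 0) (a : Fin n → ℝ) :
    fderiv ℝ (sigma1 σ) p (a, 0) = projFactor σ p * fderiv ℝ (sigma1 σ) p (0, a) +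
      fderiv ℝ (projFactor σ) p (0, a) * sigma1 σ p := by
  have h1 := fderiv_projFactor hU hσ hp h0 (0, a)
  rw [(hasFDerivAt_sigma2 hU hσ hp).2] at h1
  have h2 := (hasFDerivAt_sigma1 hU hσ hp).2 (a, 0)
  simp at h1 h2
  linarith

theorem fderiv_sigma1_vertical (hU : IsOpen U) (hσ : ContDiffOn ℝ ∞ σ U) {p : TSpace n}
    (hp : p.1 ∈ U) (a : Fin n → ℝ) : fderiv ℝ (sigma1 σ) p (0, a) = fderiv ℝ σ p.1 a := by
  simp [(hasFDerivAt_sigma1 hU hσ hp).2]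

theorem fderiv_projFactor_euler (hU : IsOpen U) (hσ : ContDiffOn ℝ ∞ σ U) {p : TSpace n}
    (hp : p.1 ∈ U) (h0 : sigma1 σ p ≠ 0) :
    fderiv ℝ (projFactor σ) p (0, p.2) = projFactor σ p := by
  have h1 := fderiv_sigma1_horizontal hU hσ hp h0 p.2
  have h2 := (hasFDerivAt_sigma1 hU hσ hp).2 (p.2, 0)
  rw [fderiv_sigma1_vertical hU hσ hp, ← sigma1_eq, h2] at h1
  simp only [map_zero, add_zero] at h1
  rw [← sigma2_eq hU hσ hp, ← projFactor_mul h0] at h1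
  refine mul_right_cancel₀ h0 ?_
  linarith

/-- The derivative of `2Pσ₀ = σ₀₀` along `yᵏ ∂/∂xᵏ` expresses `σ₀₀₀` through `P`, `P_{xᵏ} yᵏ` and
`σ₀`. -/
theorem sigma_condition_eq (hU : IsOpen U) (hσ : ContDiffOn ℝ ∞ σ U) {p : TSpace n}
    (hp : p.1 ∈ U) (h0 : sigma1 σ p ≠ 0) :
    3 * sigma2 σ p ^ 2 - 2 * sigma1 σ p * sigma3 σ p =
      4 * sigma1 σ p ^ 2 * (projFactor σ p ^ 2 - fderiv ℝ (projFactor σ) p (p.2, 0)) := by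
  have h1 := fderiv_projFactor hU hσ hp h0 (p.2, 0)
  rw [(hasFDerivAt_sigma2 hU hσ hp).2, (hasFDerivAt_sigma1 hU hσ hp).2] at h1
  simp only [map_zero, add_zero] at h1
  rw [← sigma2_eq hU hσ hp, ← sigma3_eq hU hσ hp] at h1
  simp only [zero_apply, mul_zero, add_zero] at h1
  rw [← h1, ← projFactor_mul h0]
  ring

theorem sigma_condition_iff (hU : IsOpen U) (hσ : ContDiffOn ℝ ∞ σ U) {p : TSpace n}
    (hp : p.1 ∈ U) (h0 : sigma1 σ p ≠ 0) :
    3 * sigma2 σ p ^ 2 = 2 * sigma1 σ p * sigma3 σ p ↔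
      fderiv ℝ (projFactor σ) p (p.2, 0) = projFactor σ p ^ 2 := by
  rw [← sub_eq_zero, sigma_condition_eq hU hσ hp h0]
  rw [mul_eq_zero, or_iff_right (mul_ne_zero four_ne_zero (pow_ne_zero 2 h0)), sub_eq_zero,
    eq_comm]

/-- A Finsler metric whose fundamental tensor at `p` is `c ℓᵢ ℓⱼ` lives in dimension one. -/
theorem IsFinslerMetricOn.not_rank_one (hn : 2 ≤ n) {C : Set (TSpace n)} {L : TSpace n → ℝ}
    (hL : IsFinslerMetricOn C L) {p : TSpace n} (hp : p ∈ C) (c : ℝ) (u : Fin n → ℝ)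
    (h : ∀ i j, fundamentalTensor L p i j = c * (u i * u j)) : False := by
  have : Nontrivial (Fin n) := Fin.nontrivial_iff_two_le.2 hn
  refine hL.nondegenerate p hp ?_
  rw [show fundamentalTensor L p = Matrix.vecMulVec (c • u) u from ?_, Matrix.det_vecMulVec]
  ext i j
  rw [h, Matrix.vecMulVec_apply, Pi.smul_apply, smul_eq_mul, mul_assoc]

/-- If a Finsler metric induces the spray, then `P` satisfies `P_{x^k} y^k = P²`. -/
theorem fderiv_projFactor_of_induced (hn : 2 ≤ n) (hU : IsOpen U) (hσ : ContDiffOn ℝ ∞ σ U)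
    {C : Set (TSpace n)} (hC : IsOpen C) (hCU : ∀ p ∈ C, p.1 ∈ U) (h0 : ∀ p ∈ C, sigma1 σ p ≠ 0)
    (hI : IsInducedOn C (sigmaSpray σ)) :
    ∀ p ∈ C, fderiv ℝ (projFactor σ) p (p.2, 0) = projFactor σ p ^ 2 := by
  obtain ⟨L, hL, hind⟩ := hI
  set P := projFactor σ with hPdef
  set F := sigma1 σ with hFdef
  have hPs : ∀ p ∈ C, ContDiffAt ℝ ∞ P p := fun p hp =>
    contDiffAt_projFactor hU hσ (hCU p hp) (h0 p hp)
  have hFs : ∀ p ∈ C, ContDiffAt ℝ ∞ F p := fun p hp => (hasFDerivAt_sigma1 hU hσ (hCU p hp)).1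
  have hLs : ∀ p ∈ C, ContDiffAt ℝ ∞ L p := fun p hp => hL.smooth.contDiffAt (hC.mem_nhds hp)
  have hpar := (forall_projective_eq_inducedSpray_iff hC hL
    (fun p hp => differentiableAt_of_smooth (hPs p hp))
    (fun p hp => fderiv_projFactor_euler hU hσ (hCU p hp) (h0 p hp))).1 hind
  have hFh : ∀ p ∈ C, ∀ a, fderiv ℝ F p (a, 0) = P p * fderiv ℝ F p (0, a) +
      fderiv ℝ P p (0, a) * F p := fun p hp =>
    fderiv_sigma1_horizontal hU hσ (hCU p hp) (h0 p hp)
  have hFv : ∀ p ∈ C, ∀ a, fderiv ℝ F p (0, a) = fderiv ℝ σ p.1 a := fun p hp =>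
    fderiv_sigma1_vertical hU hσ (hCU p hp)
  -- In this quotient the terms containing `P_{yᵃ}` cancel.
  set H : TSpace n → ℝ := fun q => L q / F q ^ 2 with hH
  have hHs : ∀ p ∈ C, ContDiffAt ℝ ∞ H p := fun p hp =>
    (hLs p hp).div ((hFs p hp).pow 2) (pow_ne_zero 2 (h0 p hp))
  have hLH : ∀ p ∈ C, L p = H p * F p ^ 2 := fun p hp => by
    have := h0 p hp
    simp only [hH]
    field_simp
  have hHd : ∀ p ∈ C, ∀ b, fderiv ℝ L p b =
      fderiv ℝ H p b * F p ^ 2 + 2 * (H p * F p * fderiv ℝ F p b) := by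
    intro p hp b
    have he : L =ᶠ[𝓝 p] fun q => H q * F q ^ 2 := by
      filter_upwards [hC.mem_nhds hp] with q hq using hLH q hq
    have h2 : HasFDerivAt (fun q => H q * F q ^ 2) _ p :=
      (differentiableAt_of_smooth (hHs p hp)).hasFDerivAt.mul
        ((differentiableAt_of_smooth (hFs p hp)).hasFDerivAt.pow 2)
    rw [he.fderiv_eq, h2.fderiv]
    simp
    ring
  have hHpar : ∀ p ∈ C, ∀ a, fderiv ℝ H p (a, 0) = P p * fderiv ℝ H p (0, a) := by
    intro p hp a
    refine mul_right_cancel₀ (pow_ne_zero 2 (h0 p hp)) ?_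
    linear_combination hpar p hp a - hHd p hp (a, 0) + P p * hHd p hp (0, a) -
      2 * H p * F p * hFh p hp a + 2 * fderiv ℝ P p (0, a) * hLH p hp
  have hHe : ∀ p ∈ C, fderiv ℝ H p (0, p.2) = 0 := by
    intro p hp
    have h1 := hHd p hp (0, p.2)
    have h2 := hL.homogeneous.euler hp (differentiableAt_of_smooth (hLs p hp))
    rw [hFv p hp, ← sigma1_eq, h2, hLH p hp] at h1
    push_cast at h1
    refine mul_right_cancel₀ (pow_ne_zero 2 (h0 p hp)) ?_
    linear_combination -h1
  -- This is the commutator of the fields `∂/∂xᵃ - P ∂/∂yᵃ` and `yᵏ (∂/∂xᵏ - P ∂/∂yᵏ)`, both of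
  -- which annihilate `H`. Degree-zero homogeneity of `H` removes the remaining terms.
  have hcomm : ∀ p ∈ C, ∀ a,
      (fderiv ℝ P p (p.2, 0) - P p ^ 2) * fderiv ℝ H p (0, a) = 0 := by
    intro p hp a
    have hmix : ∀ a b, fderiv ℝ (fderiv ℝ H) p b (a, 0) =
        fderiv ℝ P p b * fderiv ℝ H p (0, a) + P p * fderiv ℝ (fderiv ℝ H) p b (0, a) := by
      intro a b
      have he : (fun q => fderiv ℝ H q (a, 0)) =ᶠ[𝓝 p] fun q => P q * fderiv ℝ H q (0, a) := by
        filter_upwards [hC.mem_nhds hp] with q hq using hHpar q hq a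
      have h2 : HasFDerivAt (fun q => P q * fderiv ℝ H q (0, a)) _ p :=
        (differentiableAt_of_smooth (hPs p hp)).hasFDerivAt.mul
          ((differentiableAt_of_smooth (contDiffAt_fderiv (hHs p hp))).hasFDerivAt.clm_apply
            (hasFDerivAt_const _ p))
      rw [← fderiv_fderiv_apply_const (hHs p hp), he.fderiv_eq, h2.fderiv]
      simp
      ring
    have hPe : fderiv ℝ P p (0, p.2) = P p :=
      fderiv_projFactor_euler hU hσ (hCU p hp) (h0 p hp)
    have hs := fderiv_fderiv_comm (hHs p hp)
    have e1 := hmix a (p.2, 0)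
    have e2 := hmix p.2 (a, 0)
    have e3 := hmix a (0, p.2)
    have e4 := hmix p.2 (0, a)
    rw [hHe p hp] at e2 e4
    rw [hPe] at e3
    linear_combination -e1 + P p * e3 + hs (p.2, 0) (a, 0) + e2 + P p * hs (a, 0) (0, p.2) -
      P p * hs (p.2, 0) (0, a) - P p * e4 - P p ^ 2 * hs (0, a) (0, p.2)
  intro p hp
  by_contra hne
  -- Computing `gᵢⱼ` at `p` differentiates `H_y` once more, so its vanishing is needed on a
  -- neighbourhood; continuity of `P_{xᵏ} yᵏ - P²` supplies it.
  have hnear : ∀ᶠ q in 𝓝 p, q ∈ C ∧ ∀ a, fderiv ℝ H q (0, a) = 0 := by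
    have hcont : ContinuousAt (fun q : TSpace n => fderiv ℝ P q (q.2, 0) - P q ^ 2) p :=
      ((contDiffAt_fderiv (hPs p hp)).continuousAt.clm_apply
        (continuousAt_snd.prodMk continuousAt_const)).sub ((hPs p hp).continuousAt.pow 2)
    filter_upwards [hC.mem_nhds hp, hcont.eventually_ne (sub_ne_zero.2 hne)] with q hq hq2
    exact ⟨hq, fun a => (mul_eq_zero.1 (hcomm q hq a)).resolve_left hq2⟩
  refine hL.not_rank_one hn hp (H p) (fun i => fderiv ℝ σ p.1 (Pi.single i 1)) fun i j => ?_
  rw [fundamentalTensor_apply (hLs p hp)]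
  have he : (fun q => fderiv ℝ L q (0, Pi.single i 1)) =ᶠ[𝓝 p]
      fun q => 2 * (H q * F q * fderiv ℝ F q (0, Pi.single i 1)) := by
    filter_upwards [hnear] with q hq
    rw [hHd q hq.1, hq.2]
    ring
  have h2 : HasFDerivAt (fun q => 2 * (H q * F q * fderiv ℝ F q (0, Pi.single i 1))) _ p :=
    (((differentiableAt_of_smooth (hHs p hp)).hasFDerivAt.mul
      (differentiableAt_of_smooth (hFs p hp)).hasFDerivAt).mul
        ((differentiableAt_of_smooth (contDiffAt_fderiv (hFs p hp))).hasFDerivAt.clm_apply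
            (hasFDerivAt_const _ p))).const_mul 2
  have hFF : fderiv ℝ (fderiv ℝ F) p (0, Pi.single j 1) (0, Pi.single i 1) = 0 := by
    have hF2 : (fun q => fderiv ℝ F q (0, Pi.single i 1)) =ᶠ[𝓝 p]
        fun q => fderiv ℝ σ q.1 (Pi.single i 1) := by
      filter_upwards [hC.mem_nhds hp] with q hq using hFv q hq _
    have hd := contDiffAt_fderiv (contDiffAt_of_mem hU hσ (hCU p hp))
    have h3 : HasFDerivAt (fun q : TSpace n => fderiv ℝ σ q.1 (Pi.single i 1)) _ p :=
      ((differentiableAt_of_smooth hd).hasFDerivAt.comp p (f := Prod.fst)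
        hasFDerivAt_fst).clm_apply (hasFDerivAt_const _ p)
    rw [← fderiv_fderiv_apply_const (hFs p hp), hF2.fderiv_eq, h3.fderiv]
    simp
  rw [← fderiv_fderiv_apply_const (hLs p hp), he.fderiv_eq, h2.fderiv]
  simp [hFF, hFv p hp, hnear.self_of_nhds.2]
  ring

end ProjectiveFactor

/-! ### The Riemann curvature and the extension of the condition to all `y` -/

section Curvature

variable {n : ℕ} {U : Set (Fin n → ℝ)} {σ : (Fin n → ℝ) → ℝ}

theorem hasFDerivAt_coord (p : TSpace n) (i : Fin n) : HasFDerivAt (fun q : TSpace n => q.2 i)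
    ((ContinuousLinearMap.proj (R := ℝ) (φ := fun _ : Fin n => ℝ) i).comp
      (ContinuousLinearMap.snd ℝ (Fin n → ℝ) (Fin n → ℝ))) p :=
  ((ContinuousLinearMap.proj (R := ℝ) (φ := fun _ : Fin n => ℝ) i).comp
      (ContinuousLinearMap.snd ℝ (Fin n → ℝ) (Fin n → ℝ))).hasFDerivAt

theorem fderiv_sigmaSpray (hU : IsOpen U) (hσ : ContDiffOn ℝ ∞ σ U) {p : TSpace n}
    (hp : p.1 ∈ U) (h0 : sigma1 σ p ≠ 0) (i : Fin n) (b : TSpace n) :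
    fderiv ℝ (sigmaSpray σ i) p b =
      fderiv ℝ (projFactor σ) p b * p.2 i + projFactor σ p * b.2 i := by
  have h2 : HasFDerivAt (fun q => projFactor σ q * q.2 i) _ p :=
    (differentiableAt_of_smooth (contDiffAt_projFactor hU hσ hp h0)).hasFDerivAt.mul
      (hasFDerivAt_coord p i)
  have he : sigmaSpray σ i = fun q => projFactor σ q * q.2 i := funext (sigmaSpray_eq σ i)
  rw [he, h2.fderiv]
  simp
  ring

theorem fderiv_pdy_sigmaSpray (hU : IsOpen U) (hσ : ContDiffOn ℝ ∞ σ U) {p : TSpace n}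
    (hp : p.1 ∈ U) (h0 : sigma1 σ p ≠ 0) (i k : Fin n) (b : TSpace n) :
    fderiv ℝ (pdy k (sigmaSpray σ i)) p b =
      fderiv ℝ (fderiv ℝ (projFactor σ)) p b (0, Pi.single k 1) * p.2 i +
        fderiv ℝ (projFactor σ) p (0, Pi.single k 1) * b.2 i +
        fderiv ℝ (projFactor σ) p b * (if i = k then 1 else 0) := by
  have hP := contDiffAt_projFactor hU hσ hp h0
  have h1 : HasFDerivAt (fun q => fderiv ℝ (projFactor σ) q (0, Pi.single k 1)) _ p :=
    (differentiableAt_of_smooth (contDiffAt_fderiv hP)).hasFDerivAt.clm_apply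
      (hasFDerivAt_const _ p)
  have h2 : HasFDerivAt (fun q => fderiv ℝ (projFactor σ) q (0, Pi.single k 1) * q.2 i +
      projFactor σ q * (if i = k then 1 else 0)) _ p :=
    (h1.mul (hasFDerivAt_coord p i)).add
      ((differentiableAt_of_smooth hP).hasFDerivAt.mul_const (if i = k then 1 else 0))
  have he : pdy k (sigmaSpray σ i) =ᶠ[𝓝 p] fun q =>
      fderiv ℝ (projFactor σ) q (0, Pi.single k 1) * q.2 i +
        projFactor σ q * (if i = k then 1 else 0) := by
    filter_upwards [continuousAt_fst.preimage_mem_nhds (hU.mem_nhds hp),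
      (hasFDerivAt_sigma1 hU hσ hp).1.continuousAt.eventually_ne h0] with q hq hq0
    rw [pdy, fderiv_sigmaSpray hU hσ hq hq0]
    simp [Pi.single_apply]
  rw [he.fderiv_eq, h2.fderiv]
  split_ifs <;> simp <;> ring

theorem fderiv_fderiv_projFactor_vertical (hU : IsOpen U) (hσ : ContDiffOn ℝ ∞ σ U)
    {p : TSpace n} (hp : p.1 ∈ U) (h0 : sigma1 σ p ≠ 0) (a : Fin n → ℝ) :
    fderiv ℝ (fderiv ℝ (projFactor σ)) p (0, p.2) (0, a) = 0 := by
  have hP := contDiffAt_projFactor hU hσ hp h0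
  have he : (fun q => fderiv ℝ (projFactor σ) q (0, q.2)) =ᶠ[𝓝 p] projFactor σ := by
    filter_upwards [continuousAt_fst.preimage_mem_nhds (hU.mem_nhds hp),
      (hasFDerivAt_sigma1 hU hσ hp).1.continuousAt.eventually_ne h0] with q hq hq0
    exact fderiv_projFactor_euler hU hσ hq hq0
  have h1 := fderiv_fderiv_apply_field hP (hasFDerivAt_vertical p) (0, a)
  rw [he.fderiv_eq, fderiv_fderiv_comm hP] at h1
  simpa using h1

/-- Product rule for `P yⁱ`, with `P` homogeneous of degree one. The `δⁱₖ` terms are `-P_{xʲ} yʲ`,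
`2P²` and `-P²`; all others are multiples of `yⁱ`. -/
theorem riemannCurvature_sigmaSpray (hU : IsOpen U) (hσ : ContDiffOn ℝ ∞ σ U) {p : TSpace n}
    (hp : p.1 ∈ U) (h0 : sigma1 σ p ≠ 0) (i k : Fin n) :
    riemannCurvature (sigmaSpray σ) i k p =
      (if i = k then projFactor σ p ^ 2 - fderiv ℝ (projFactor σ) p (p.2, 0) else 0) -
        (fderiv ℝ (fderiv ℝ (projFactor σ)) p (p.2, 0) (0, Pi.single k 1) -
          2 * fderiv ℝ (projFactor σ) p (Pi.single k 1, 0) +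
          projFactor σ p * fderiv ℝ (projFactor σ) p (0, Pi.single k 1)) * p.2 i := by
  set P := projFactor σ with hPdef
  have s1 : ∑ j, p.2 j * pdx j (pdy k (sigmaSpray σ i)) p =
      fderiv ℝ (pdy k (sigmaSpray σ i)) p (p.2, 0) := by
    rw [apply_inl_eq_sum]
    exact Finset.sum_congr rfl fun j _ => mul_comm _ _
  have s2 : ∑ j, sigmaSpray σ j p * pdy j (pdy k (sigmaSpray σ i)) p =
      P p * fderiv ℝ (pdy k (sigmaSpray σ i)) p (0, p.2) := by
    rw [apply_inr_eq_sum, Finset.mul_sum]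
    refine Finset.sum_congr rfl fun j _ => ?_
    rw [sigmaSpray_eq, pdy]
    ring
  have s3 : ∑ j, pdy j (sigmaSpray σ i) p * pdy k (sigmaSpray σ j) p =
      fderiv ℝ (sigmaSpray σ i) p
        (0, fderiv ℝ P p (0, Pi.single k 1) • p.2 + P p • Pi.single k 1) := by
    rw [apply_inr_eq_sum]
    refine Finset.sum_congr rfl fun j _ => ?_
    rw [pdy, pdy, fderiv_sigmaSpray hU hσ hp h0 j]
    rfl
  have s4 : fderiv ℝ P p (0, fderiv ℝ P p (0, Pi.single k 1) • p.2 + P p • Pi.single k 1) =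
      2 * (P p * fderiv ℝ P p (0, Pi.single k 1)) := by
    have : ((0, fderiv ℝ P p (0, Pi.single k 1) • p.2 + P p • Pi.single k 1) : TSpace n) =
        fderiv ℝ P p (0, Pi.single k 1) • (0, p.2) + P p • (0, Pi.single k 1) := by
      simp
    rw [this, map_add, map_smul, map_smul, fderiv_projFactor_euler hU hσ hp h0, ← hPdef,
      smul_eq_mul, smul_eq_mul]
    ring
  rw [riemannCurvature, s1, s2, s3, pdx, fderiv_sigmaSpray hU hσ hp h0,
    fderiv_sigmaSpray hU hσ hp h0, fderiv_pdy_sigmaSpray hU hσ hp h0,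
    fderiv_pdy_sigmaSpray hU hσ hp h0, fderiv_fderiv_projFactor_vertical hU hσ hp h0,
    fderiv_projFactor_euler hU hσ hp h0, ← hPdef, s4]
  simp only [Pi.add_apply, Pi.smul_apply, Pi.single_apply, Pi.zero_apply, smul_eq_mul]
  split_ifs <;> ring

variable {C : Set (TSpace n)}

theorem fderiv_projFactor_of_zeroScalarCurvature (hn : 2 ≤ n) (hU : IsOpen U)
    (hσ : ContDiffOn ℝ ∞ σ U) (hC : IsConicalRegion U C) (h0 : ∀ p ∈ C, sigma1 σ p ≠ 0)
    (h : IsOfZeroScalarCurvature C (sigmaSpray σ)) :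
    ∀ p ∈ C, fderiv ℝ (projFactor σ) p (p.2, 0) = projFactor σ p ^ 2 := by
  obtain ⟨R, ⟨-, τ, -, hRτ⟩, hR⟩ := h
  intro p hp
  have : Nontrivial (Fin n) := Fin.nontrivial_iff_two_le.2 hn
  -- An off-diagonal entry in a row with `yⁱ ≠ 0` determines `τₖ`; the diagonal entry in column `k`
  -- then isolates the scalar. Such a `k ≠ i` exists because `n ≥ 2`.
  obtain ⟨i, hi⟩ := Function.ne_iff.1 (hC.ne_zero p hp)
  obtain ⟨k, hk⟩ := exists_ne i
  have h1 := hRτ p hp i k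
  have h2 := hRτ p hp k k
  rw [riemannCurvature_sigmaSpray hU hσ (hC.base_mem p hp) (h0 p hp), hR p hp] at h1 h2
  rw [if_neg hk.symm, if_neg hk.symm] at h1
  rw [if_pos rfl, if_pos rfl] at h2
  have h3 := mul_right_cancel₀ hi (sub_right_injective h1)
  rw [h3] at h2
  linarith

/-- Even `τ = 0` works: differentiating `P_{xʲ} yʲ = P²` in `yᵏ` reduces the explicit `τₖ` to `3 (P
P_{yᵏ} - P_{xᵏ})`. -/
theorem zeroScalarCurvature_of_fderiv_projFactor (hU : IsOpen U) (hσ : ContDiffOn ℝ ∞ σ U)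
    (hC : IsConicalRegion U C) (h0 : ∀ p ∈ C, sigma1 σ p ≠ 0)
    (h : ∀ p ∈ C, ∀ a, fderiv ℝ (projFactor σ) p (a, 0) =
      projFactor σ p * fderiv ℝ (projFactor σ) p (0, a)) :
    IsOfZeroScalarCurvature C (sigmaSpray σ) := by
  refine ⟨0, ⟨fun p _ t _ => by simp, 0, fun k p _ t _ => by simp, ?_⟩, fun _ _ => rfl⟩
  intro p hp i k
  have hP := fun q (hq : q ∈ C) => contDiffAt_projFactor hU hσ (hC.base_mem q hq) (h0 q hq)
  have hsq : ∀ q ∈ C, fderiv ℝ (projFactor σ) q (q.2, 0) = projFactor σ q ^ 2 := by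
    intro q hq
    rw [h q hq, fderiv_projFactor_euler hU hσ (hC.base_mem q hq) (h0 q hq), sq]
  have he : (fun q => fderiv ℝ (projFactor σ) q (q.2, 0)) =ᶠ[𝓝 p] fun q => projFactor σ q ^ 2 := by
    filter_upwards [hC.isOpen.mem_nhds hp] with q hq using hsq q hq
  have h1 := fderiv_fderiv_apply_field (hP p hp) (hasFDerivAt_horizontal p) (0, Pi.single k 1)
  have h2 : HasFDerivAt (fun q => projFactor σ q ^ 2) _ p :=
    (differentiableAt_of_smooth (hP p hp)).hasFDerivAt.pow 2
  rw [he.fderiv_eq, h2.fderiv, fderiv_fderiv_comm (hP p hp)] at h1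
  simp at h1
  rw [riemannCurvature_sigmaSpray hU hσ (hC.base_mem p hp) (h0 p hp), hsq p hp]
  have h3 := h p hp (Pi.single k 1)
  rw [show fderiv ℝ (fderiv ℝ (projFactor σ)) p (p.2, 0) (0, Pi.single k 1) -
      2 * fderiv ℝ (projFactor σ) p (Pi.single k 1, 0) +
      projFactor σ p * fderiv ℝ (projFactor σ) p (0, Pi.single k 1) = 0 by linarith]
  simp

theorem isSprayOn_sigmaSpray (hU : IsOpen U) (hσ : ContDiffOn ℝ ∞ σ U)
    (hC : IsConicalRegion U C) (h0 : ∀ p ∈ C, sigma1 σ p ≠ 0) :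
    IsSprayOn C (sigmaSpray σ) := by
  constructor
  · intro i p hp
    exact ((contDiffAt_projFactor hU hσ (hC.base_mem p hp) (h0 p hp)).mul
      (contDiff_apply ℝ ℝ i |>.contDiffAt.comp p contDiffAt_snd)).contDiffWithinAt
  · intro i p hp t ht
    have hq : (p.1, t • p.2).1 ∈ U := hC.base_mem p hp
    have h1 := h0 p hp
    rw [sigma1_eq] at h1
    simp only [sigmaSpray]
    rw [sigma2_eq hU hσ hq, sigma2_eq hU hσ (hC.base_mem p hp), sigma1_eq, sigma1_eq]
    simp only [map_smul, smul_apply, smul_eq_mul, Pi.smul_apply]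
    field_simp

/-- Both sides of the condition on `σ` are polynomial in `y`, so an open set of `y` suffices. -/
theorem sigma_condition_extend {x : Fin n → ℝ} {S : Set (TSpace n)} (hS : IsOpen S)
    (hne : ∃ y, (x, y) ∈ S)
    (h : ∀ p ∈ S, 3 * sigma2 σ p ^ 2 = 2 * sigma1 σ p * sigma3 σ p) (y : Fin n → ℝ) :
    3 * sigma2 σ (x, y) ^ 2 = 2 * sigma1 σ (x, y) * sigma3 σ (x, y) := by
  obtain ⟨y₀, hy₀⟩ := hne
  have hc : ∀ i, AnalyticOnNhd ℝ (fun y : Fin n → ℝ => y i) Set.univ := fun i =>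
    (ContinuousLinearMap.proj (R := ℝ) (φ := fun _ : Fin n => ℝ) i).analyticOnNhd _
  have h1 : AnalyticOnNhd ℝ (fun y => sigma1 σ (x, y)) Set.univ :=
    Finset.analyticOnNhd_fun_sum _ fun i _ =>
      (analyticOnNhd_const (v := pd i σ x)).mul (hc i)
  have h2 : AnalyticOnNhd ℝ (fun y => sigma2 σ (x, y)) Set.univ :=
    Finset.analyticOnNhd_fun_sum _ fun i _ => Finset.analyticOnNhd_fun_sum _ fun j _ =>
      ((analyticOnNhd_const (v := pd j (pd i σ) x)).mul (hc i)).mul (hc j)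
  have h3 : AnalyticOnNhd ℝ (fun y => sigma3 σ (x, y)) Set.univ :=
    Finset.analyticOnNhd_fun_sum _ fun i _ => Finset.analyticOnNhd_fun_sum _ fun j _ =>
      Finset.analyticOnNhd_fun_sum _ fun k _ =>
        (((analyticOnNhd_const (v := pd k (pd j (pd i σ)) x)).mul (hc i)).mul (hc j)).mul (hc k)
  refine congrFun (AnalyticOnNhd.eq_of_eventuallyEq (z₀ := y₀)
    (f := fun y => 3 * sigma2 σ (x, y) ^ 2)
    (g := fun y => 2 * sigma1 σ (x, y) * sigma3 σ (x, y))
    (analyticOnNhd_const.mul (h2.pow 2)) ((analyticOnNhd_const.mul h1).mul h3) ?_) y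
  have hcont : ContinuousAt (fun y : Fin n → ℝ => (x, y)) y₀ := by fun_prop
  filter_upwards [hcont.preimage_mem_nhds (hS.mem_nhds hy₀)] with y hy using h _ hy

end Curvature

/-! ### The condition on `σ` makes `P` a linear form `p` with `∂ₖ pᵢ = pᵢ pₖ` -/

section ConnectionForm

variable {n : ℕ} {U : Set (Fin n → ℝ)} {σ : (Fin n → ℝ) → ℝ}

/-- The gradient of `σ` rescaled so that `dσ` takes the value one on it. -/
def unitGradient (σ : (Fin n → ℝ) → ℝ) (x : Fin n → ℝ) : Fin n → ℝ :=
  (∑ j, pd j σ x ^ 2)⁻¹ • fun i => pd i σ x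

theorem sum_pd_sq_ne_zero {x y : Fin n → ℝ} (h : sigma1 σ (x, y) ≠ 0) :
    ∑ j, pd j σ x ^ 2 ≠ 0 := by
  intro h0
  rw [Finset.sum_eq_zero_iff_of_nonneg fun i _ => sq_nonneg _] at h0
  refine h (Finset.sum_eq_zero fun i hi => ?_)
  rw [show pd i σ (x, y).1 = 0 from pow_eq_zero_iff two_ne_zero |>.1 (h0 i hi), zero_mul]

theorem fderiv_unitGradient {x : Fin n → ℝ} (h : ∃ y, sigma1 σ (x, y) ≠ 0) :
    fderiv ℝ σ x (unitGradient σ x) = 1 := by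
  obtain ⟨y, hy⟩ := h
  have h1 : ∑ i, fderiv ℝ σ x (Pi.single i 1) * pd i σ x = ∑ i, pd i σ x ^ 2 :=
    Finset.sum_congr rfl fun i _ => (sq _).symm
  rw [unitGradient, map_smul, apply_eq_sum_single, smul_eq_mul, h1,
    inv_mul_cancel₀ (sum_pd_sq_ne_zero hy)]

theorem differentiableAt_unitGradient (hU : IsOpen U) (hσ : ContDiffOn ℝ ∞ σ U) {x : Fin n → ℝ}
    (hx : x ∈ U) (h : ∃ y, sigma1 σ (x, y) ≠ 0) : DifferentiableAt ℝ (unitGradient σ) x := by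
  obtain ⟨y, hy⟩ := h
  have hd : ∀ i, DifferentiableAt ℝ (pd i σ) x := fun i =>
    (differentiableAt_of_smooth (contDiffAt_fderiv (contDiffAt_of_mem hU hσ hx))).clm_apply
      (differentiableAt_const _)
  have h1 : DifferentiableAt ℝ (fun x => ∑ j, pd j σ x ^ 2) x :=
    DifferentiableAt.fun_sum fun j _ => (hd j).pow 2
  exact (h1.inv (sum_pd_sq_ne_zero hy)).smul (differentiableAt_pi.2 hd)

/-- The covector field `p` with `σᵢⱼ = pᵢ σⱼ + pⱼ σᵢ` when `σ₀ ∣ σ₀₀`. -/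
def projForm (σ : (Fin n → ℝ) → ℝ) (x : Fin n → ℝ) : (Fin n → ℝ) →L[ℝ] ℝ :=
  fderiv ℝ (fderiv ℝ σ) x (unitGradient σ x) -
    (fderiv ℝ (fderiv ℝ σ) x (unitGradient σ x) (unitGradient σ x) / 2) • fderiv ℝ σ x

theorem differentiableAt_projForm (hU : IsOpen U) (hσ : ContDiffOn ℝ ∞ σ U) {x : Fin n → ℝ}
    (hx : x ∈ U) (h : ∃ y, sigma1 σ (x, y) ≠ 0) : DifferentiableAt ℝ (projForm σ) x := by
  have h0 := contDiffAt_fderiv (contDiffAt_of_mem hU hσ hx)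
  have hv := differentiableAt_unitGradient hU hσ hx h
  have h2 := (differentiableAt_of_smooth (contDiffAt_fderiv h0)).clm_apply hv
  have h3 : DifferentiableAt ℝ (fun x =>
      fderiv ℝ (fderiv ℝ σ) x (unitGradient σ x) (unitGradient σ x) / 2) x := by
    simpa only [div_eq_mul_inv] using (h2.clm_apply hv).mul_const (2 : ℝ)⁻¹
  exact h2.fun_sub (h3.fun_smul (differentiableAt_of_smooth h0))

section Condition

variable (hU : IsOpen U) (hσ : ContDiffOn ℝ ∞ σ U) (hσ0 : ∀ x ∈ U, ∃ y, sigma1 σ (x, y) ≠ 0)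
  (h5 : ∀ x ∈ U, ∀ y, 3 * sigma2 σ (x, y) ^ 2 = 2 * sigma1 σ (x, y) * sigma3 σ (x, y))

include hU hσ hσ0 h5

theorem hessian_eq {x : Fin n → ℝ} (hx : x ∈ U) (a b : Fin n → ℝ) :
    fderiv ℝ (fderiv ℝ σ) x a b =
      projForm σ x a * fderiv ℝ σ x b + projForm σ x b * fderiv ℝ σ x a := by
  have hv := fderiv_unitGradient (hσ0 x hx)
  have hs := fderiv_fderiv_comm (contDiffAt_of_mem hU hσ hx)
  -- At `σ₀ = 0` the condition reads `3 σ₀₀² = 0`; polarization then kills the Hessian on the whole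
  -- kernel.
  have hker : ∀ z, fderiv ℝ σ x z = 0 → fderiv ℝ (fderiv ℝ σ) x z z = 0 := by
    intro z hz
    have h := h5 x hx z
    rw [sigma1_eq, hz, sigma2_eq hU hσ (p := (x, z)) hx] at h
    simpa using h
  have hker2 : ∀ z w, fderiv ℝ σ x z = 0 → fderiv ℝ σ x w = 0 →
      fderiv ℝ (fderiv ℝ σ) x z w = 0 := by
    intro z w hz hw
    have h := hker (z + w) (by rw [map_add, hz, hw, add_zero])
    simp only [map_add, add_apply, hker z hz, hker w hw] at h
    linarith [hs z w]
  -- Removing the components along the unit gradient `v` lands in the kernel; expanding by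
  -- bilinearity gives the formula.
  have h := hker2 (a - fderiv ℝ σ x a • unitGradient σ x) (b - fderiv ℝ σ x b • unitGradient σ x)
    (by simp [hv]) (by simp [hv])
  simp only [map_sub, map_smul, sub_apply, smul_apply, smul_eq_mul] at h
  simp only [projForm, sub_apply, smul_apply, smul_eq_mul]
  rw [hs a (unitGradient σ x)] at h
  linarith

theorem projFactor_eq {p : TSpace n} (hp : p.1 ∈ U) (h0 : sigma1 σ p ≠ 0) :
    projFactor σ p = projForm σ p.1 p.2 := by
  rw [projFactor, sigma2_eq hU hσ hp, hessian_eq hU hσ hσ0 h5 hp, ← sigma1_eq]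
  field_simp
  norm_num

theorem fderiv3_eq {x : Fin n → ℝ} (hx : x ∈ U) (c a b : Fin n → ℝ) :
    fderiv ℝ (fderiv ℝ (fderiv ℝ σ)) x c a b =
      fderiv ℝ (projForm σ) x c a * fderiv ℝ σ x b +
        projForm σ x a * fderiv ℝ (fderiv ℝ σ) x c b +
        fderiv ℝ (projForm σ) x c b * fderiv ℝ σ x a +
        projForm σ x b * fderiv ℝ (fderiv ℝ σ) x c a := by
  have he : (fun z => fderiv ℝ (fderiv ℝ σ) z a b) =ᶠ[𝓝 x] fun z =>
      projForm σ z a * fderiv ℝ σ z b + projForm σ z b * fderiv ℝ σ z a := by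
    filter_upwards [hU.mem_nhds hx] with z hz using hessian_eq hU hσ hσ0 h5 hz a b
  have hp : ∀ a, HasFDerivAt (fun z => projForm σ z a) _ x := fun a =>
    (differentiableAt_projForm hU hσ hx (hσ0 x hx)).hasFDerivAt.clm_apply (hasFDerivAt_const a x)
  have hd : ∀ a, HasFDerivAt (fun z => fderiv ℝ σ z a) _ x := fun a =>
    (differentiableAt_of_smooth
      (contDiffAt_fderiv (contDiffAt_of_mem hU hσ hx))).hasFDerivAt.clm_apply
        (hasFDerivAt_const a x)
  have h2 : HasFDerivAt (fun z =>
      projForm σ z a * fderiv ℝ σ z b + projForm σ z b * fderiv ℝ σ z a) _ x :=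
    ((hp a).mul (hd b)).add ((hp b).mul (hd a))
  rw [← fderiv3_apply hU hσ hx, he.fderiv_eq, h2.fderiv]
  simp
  ring

theorem fderiv_projForm_diag {x : Fin n → ℝ} (hx : x ∈ U) (y : Fin n → ℝ) :
    fderiv ℝ (projForm σ) x y y = projForm σ x y ^ 2 := by
  have hne : ∀ y, fderiv ℝ σ x y ≠ 0 → fderiv ℝ (projForm σ) x y y = projForm σ x y ^ 2 := by
    intro y hy
    have h := h5 x hx y
    rw [sigma1_eq, sigma2_eq hU hσ (p := (x, y)) hx, sigma3_eq hU hσ (p := (x, y)) hx,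
      fderiv3_eq hU hσ hσ0 h5 hx, hessian_eq hU hσ hσ0 h5 hx] at h
    refine mul_right_cancel₀ (pow_ne_zero 2 hy) ?_
    linear_combination -h / 4
  have hv := fderiv_unitGradient (hσ0 x hx)
  rcases ne_or_eq (fderiv ℝ σ x y) 0 with hy | hy
  · exact hne y hy
  -- On the line `y + t v` one has `σ₀ = t`. The difference of the two sides is a polynomial of
  -- degree at most two in `t` vanishing at `1, -1, 2`, hence also at `0`.
  have ht : ∀ t : ℝ, t ≠ 0 → fderiv ℝ (projForm σ) x (y + t • unitGradient σ x)
      (y + t • unitGradient σ x) = projForm σ x (y + t • unitGradient σ x) ^ 2 := fun t ht =>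
    hne _ (by simp [hv, hy, ht])
  have h1 := ht 1 one_ne_zero
  have h2 := ht (-1) (by norm_num)
  have h3 := ht 2 two_ne_zero
  simp only [map_add, map_smul, add_apply, smul_apply, smul_eq_mul] at h1 h2 h3
  linarith

/-- The condition on `σ` is equivalent to `p_{i,k} = pᵢ pₖ`: the connection is flat. -/
theorem fderiv_projForm {x : Fin n → ℝ} (hx : x ∈ U) (a b : Fin n → ℝ) :
    fderiv ℝ (projForm σ) x a b = projForm σ x a * projForm σ x b := by
  have hv := fderiv_unitGradient (hσ0 x hx)
  have hd := fderiv_projForm_diag hU hσ hσ0 h5 hx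
  have hsym : ∀ a b, fderiv ℝ (projForm σ) x a b + fderiv ℝ (projForm σ) x b a =
      2 * (projForm σ x a * projForm σ x b) := by
    intro a b
    have h := hd (a + b)
    simp only [map_add, add_apply, hd] at h
    linarith
  -- Symmetry of the third derivative in its first two slots, written for the defect `T(c, a) = (∂_c
  -- p)(a) - p(c) p(a)`, which is antisymmetric by `hsym`.
  have hT : ∀ a b c, 2 * (fderiv ℝ (projForm σ) x c a - projForm σ x c * projForm σ x a) *
        fderiv ℝ σ x b +
      (fderiv ℝ (projForm σ) x c b - projForm σ x c * projForm σ x b) * fderiv ℝ σ x a -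
      (fderiv ℝ (projForm σ) x a b - projForm σ x a * projForm σ x b) * fderiv ℝ σ x c = 0 := by
    intro a b c
    have h := fderiv3_comm_left hU hσ hx c a b
    simp only [fderiv3_eq hU hσ hσ0 h5 hx, hessian_eq hU hσ hσ0 h5 hx] at h
    linear_combination h + hsym a c * fderiv ℝ σ x b
  -- With `a = b = v` the relation becomes `3 T(c, v) = 0`, as `T(v, v) = 0`. Then setting only `b =
  -- v` leaves `2 T = 0`.
  have h1 : ∀ c, fderiv ℝ (projForm σ) x c (unitGradient σ x) -
      projForm σ x c * projForm σ x (unitGradient σ x) = 0 := by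
    intro c
    have h := hT (unitGradient σ x) (unitGradient σ x) c
    rw [hv, hd] at h
    linarith
  have h2 := hT b (unitGradient σ x) a
  rw [h1, h1, hv] at h2
  linarith

theorem fderiv_projFactor_horizontal {C : Set (TSpace n)} (hC : IsConicalRegion U C)
    (h0 : ∀ p ∈ C, sigma1 σ p ≠ 0) {p : TSpace n} (hp : p ∈ C) (a : Fin n → ℝ) :
    fderiv ℝ (projFactor σ) p (0, a) = projForm σ p.1 a ∧
    fderiv ℝ (projFactor σ) p (a, 0) =
      projFactor σ p * fderiv ℝ (projFactor σ) p (0, a) := by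
  have hpU := hC.base_mem p hp
  have he : projFactor σ =ᶠ[𝓝 p] fun q => projForm σ q.1 q.2 := by
    filter_upwards [hC.isOpen.mem_nhds hp] with q hq
    exact projFactor_eq hU hσ hσ0 h5 (hC.base_mem q hq) (h0 q hq)
  have hd : HasFDerivAt (fun q : TSpace n => projForm σ q.1) _ p :=
    (differentiableAt_projForm hU hσ hpU (hσ0 _ hpU)).hasFDerivAt.comp p (f := Prod.fst)
      hasFDerivAt_fst
  rw [he.fderiv_eq, he.self_of_nhds, (hd.clm_apply hasFDerivAt_snd).fderiv]
  simp
  rw [fderiv_projForm hU hσ hσ0 h5 hpU, mul_comm]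

end Condition

end ConnectionForm

/-! ### Integrating `p`, and the projectively flat model metric -/

section Model

section FlatForm

variable {X : Type*} [NormedAddCommGroup X] [NormedSpace ℝ X]

/-- The affine function `1 - ℓ (x - x₀)`. -/
def affineDenom (ℓ : X →L[ℝ] ℝ) (x₀ x : X) : ℝ := 1 - ℓ (x - x₀)

theorem hasFDerivAt_affineDenom (ℓ : X →L[ℝ] ℝ) (x₀ x : X) :
    HasFDerivAt (affineDenom ℓ x₀) (-ℓ) x := by
  have h : HasFDerivAt (fun x => ℓ (x - x₀)) ℓ x := by
    simp_rw [map_sub]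
    exact ℓ.hasFDerivAt.sub_const _
  exact h.const_sub 1

variable {U : Set X} {θ : X → X →L[ℝ] ℝ}

theorem hasFDerivAt_affineDenom_smul_sub (hd : ∀ x ∈ U, DifferentiableAt ℝ θ x)
    (hθ : ∀ x ∈ U, ∀ a b, fderiv ℝ θ x a b = θ x a * θ x b) (ℓ : X →L[ℝ] ℝ) (x₀ : X) {x : X}
    (hx : x ∈ U) : HasFDerivAt (fun z => affineDenom ℓ x₀ z • θ z - ℓ)
      ((affineDenom ℓ x₀ x • θ x - ℓ).smulRight (θ x)) x := by
  have h := ((hasFDerivAt_affineDenom ℓ x₀ x).fun_smul (hd x hx).hasFDerivAt).sub_const ℓ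
  refine h.congr_fderiv ?_
  ext a b
  simp only [add_apply, smul_apply, ContinuousLinearMap.smulRight_apply, sub_apply, neg_apply,
    smul_eq_mul, hθ x hx]
  ring

/-- By the preceding derivative formula, `Bθ - ℓ` solves a homogeneous linear ODE along each segment
from `x`. With `θ` bounded on a small ball, Grönwall's inequality propagates the zero. -/
theorem eventually_affineDenom_smul_sub_eq_zero (hU : IsOpen U)
    (hd : ∀ x ∈ U, DifferentiableAt ℝ θ x)
    (hθ : ∀ x ∈ U, ∀ a b, fderiv ℝ θ x a b = θ x a * θ x b) (ℓ : X →L[ℝ] ℝ) (x₀ : X) {x : X}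
    (hx : x ∈ U) (h0 : affineDenom ℓ x₀ x • θ x - ℓ = 0) :
    ∀ᶠ z in 𝓝 x, affineDenom ℓ x₀ z • θ z - ℓ = 0 := by
  have hb : ∀ᶠ z in 𝓝 x, z ∈ U ∧ ‖θ z‖ < ‖θ x‖ + 1 :=
    (hU.eventually_mem hx).and ((hd x hx).continuousAt.norm.eventually_lt_const (lt_add_one _))
  obtain ⟨r, hr, hball⟩ := Metric.eventually_nhds_iff_ball.1 hb
  filter_upwards [Metric.ball_mem_nhds x hr] with z hz
  have hmem : ∀ t ∈ Set.Icc (0 : ℝ) 1, x + t • (z - x) ∈ Metric.ball x r := fun t ht =>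
    (convex_ball x r).add_smul_sub_mem (Metric.mem_ball_self hr) hz ht
  set f : ℝ → X →L[ℝ] ℝ := fun t =>
    affineDenom ℓ x₀ (x + t • (z - x)) • θ (x + t • (z - x)) - ℓ with hf
  have hder : ∀ t ∈ Set.Icc (0 : ℝ) 1, HasDerivAt f (f t (z - x) • θ (x + t • (z - x))) t := by
    intro t ht
    have h1 : HasDerivAt (fun t : ℝ => x + t • (z - x)) (z - x) t := by
      simpa using ((hasDerivAt_id t).smul_const (z - x)).const_add x
    exact (hasFDerivAt_affineDenom_smul_sub hd hθ ℓ x₀ (hball _ (hmem t ht)).1).comp_hasDerivAt t h1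
  have hzero := eq_zero_of_abs_deriv_le_mul_abs_self_of_eq_zero_right (f := f)
    (K := ‖z - x‖ * (‖θ x‖ + 1))
    (fun t ht => (hder t ht).continuousAt.continuousWithinAt)
    (fun t ht => (hder t (Set.Ico_subset_Icc_self ht)).hasDerivWithinAt)
    (by simpa [hf] using h0) (fun t ht => ?_) 1 (Set.right_mem_Icc.2 zero_le_one)
  · simpa [hf] using hzero
  · rw [norm_smul]
    calc ‖f t (z - x)‖ * ‖θ (x + t • (z - x))‖
        ≤ (‖f t‖ * ‖z - x‖) * (‖θ x‖ + 1) := by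
          gcongr
          · exact (f t).le_opNorm _
          · exact (hball _ (hmem t (Set.Ico_subset_Icc_self ht))).2.le
      _ = ‖z - x‖ * (‖θ x‖ + 1) * ‖f t‖ := by ring

/-- A form with `θ_{i,k} = θᵢ θₖ` is `-d log B` for an affine function `B`, on any preconnected
set. -/
theorem affineDenom_smul_eq (hU : IsOpen U) (hd : ∀ x ∈ U, DifferentiableAt ℝ θ x)
    (hθ : ∀ x ∈ U, ∀ a b, fderiv ℝ θ x a b = θ x a * θ x b) {W : Set X} (hW : IsPreconnected W)
    (hWU : W ⊆ U) {x₀ x : X} (hx₀ : x₀ ∈ W) (hx : x ∈ W) :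
    affineDenom (θ x₀) x₀ x • θ x = θ x₀ ∧ affineDenom (θ x₀) x₀ x ≠ 0 := by
  have h0 : affineDenom (θ x₀) x₀ x₀ • θ x₀ - θ x₀ = 0 := by simp [affineDenom]
  have hev := fun z (hz : z ∈ U) =>
    eventually_affineDenom_smul_sub_eq_zero hU hd hθ (θ x₀) x₀ (x := z) hz
  -- Connectedness: the set where `Bθ = ℓ` holds locally is open, and closed relative to `W` by
  -- continuity and local propagation.
  have hsub := hW.subset_of_closure_inter_subset
    (u := {z | ∀ᶠ w in 𝓝 z, affineDenom (θ x₀) x₀ w • θ w - θ x₀ = 0})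
    isOpen_setOfPred_eventually_nhds ⟨x₀, hx₀, hev x₀ (hWU hx₀) h0⟩ ?_
  · have h1 := sub_eq_zero.1 (hsub hx).self_of_nhds
    -- If `B` vanished at `x`, then `ℓ = Bθ = 0` and so `B` would be identically `1`.
    refine ⟨h1, fun hz => ?_⟩
    rw [hz, zero_smul] at h1
    simp [affineDenom, ← h1] at hz
  · rintro z ⟨hz, hzW⟩
    refine hev z (hWU hzW) ?_
    have hcont : ContinuousAt (fun w => affineDenom (θ x₀) x₀ w • θ w - θ x₀) z :=
      (hasFDerivAt_affineDenom_smul_sub hd hθ (θ x₀) x₀ (hWU hzW)).continuousAt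
    by_contra hne
    obtain ⟨w, hw, hw'⟩ := mem_closure_iff_nhds.1 hz _ (hcont.eventually_ne hne)
    exact hw hw'.self_of_nhds

end FlatForm

variable {n : ℕ}

/-- The components of the velocity of `(x - x₀) / (1 - ℓ (x - x₀))`. -/
def modelField (ℓ : (Fin n → ℝ) →L[ℝ] ℝ) (x₀ : Fin n → ℝ) (i : Fin n) (p : TSpace n) : ℝ :=
  (affineDenom ℓ x₀ p.1)⁻¹ * p.2 i + (affineDenom ℓ x₀ p.1)⁻¹ ^ 2 * ((p.1 i - x₀ i) * ℓ p.2)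

/-- The flat metric pulled back by the projective map `(x - x₀) / (1 - ℓ (x - x₀))`. -/
def modelMetric (ℓ : (Fin n → ℝ) →L[ℝ] ℝ) (x₀ : Fin n → ℝ) (p : TSpace n) : ℝ :=
  ∑ i, modelField ℓ x₀ i p ^ 2

variable {ℓ : (Fin n → ℝ) →L[ℝ] ℝ} {x₀ : Fin n → ℝ} {p : TSpace n}

theorem contDiffAt_modelField (h : affineDenom ℓ x₀ p.1 ≠ 0) (i : Fin n) :
    ContDiffAt ℝ ∞ (modelField ℓ x₀ i) p := by
  have h1 : ContDiff ℝ ∞ (fun q : TSpace n => affineDenom ℓ x₀ q.1) :=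
    contDiff_const.sub (ℓ.contDiff.comp (contDiff_fst.sub contDiff_const))
  have h2 := h1.contDiffAt.inv h
  have h3 : ContDiff ℝ ∞ (fun q : TSpace n => q.1 i) := (contDiff_apply ℝ ℝ i).comp contDiff_fst
  have h4 : ContDiff ℝ ∞ (fun q : TSpace n => q.2 i) := (contDiff_apply ℝ ℝ i).comp contDiff_snd
  have h5 : ContDiff ℝ ∞ (fun q : TSpace n => ℓ q.2) := ℓ.contDiff.comp contDiff_snd
  exact (h2.mul h4.contDiffAt).add
    ((h2.pow 2).mul ((h3.sub contDiff_const).mul h5).contDiffAt)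

theorem contDiffAt_modelMetric (h : affineDenom ℓ x₀ p.1 ≠ 0) :
    ContDiffAt ℝ ∞ (modelMetric ℓ x₀) p :=
  ContDiffAt.sum fun i _ => (contDiffAt_modelField h i).pow 2

theorem fderiv_modelField (h : affineDenom ℓ x₀ p.1 ≠ 0) (i : Fin n) (b : TSpace n) :
    fderiv ℝ (modelField ℓ x₀ i) p b =
      (affineDenom ℓ x₀ p.1)⁻¹ ^ 2 * ℓ b.1 * p.2 i + (affineDenom ℓ x₀ p.1)⁻¹ * b.2 i +
      2 * (affineDenom ℓ x₀ p.1)⁻¹ ^ 3 * ℓ b.1 * ((p.1 i - x₀ i) * ℓ p.2) +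
      (affineDenom ℓ x₀ p.1)⁻¹ ^ 2 * (b.1 i * ℓ p.2 + (p.1 i - x₀ i) * ℓ b.2) := by
  have h1 : HasFDerivAt (fun q : TSpace n => affineDenom ℓ x₀ q.1) _ p :=
    (hasFDerivAt_affineDenom ℓ x₀ p.1).comp p (f := Prod.fst) hasFDerivAt_fst
  have h2 : HasFDerivAt (fun q : TSpace n => (affineDenom ℓ x₀ q.1)⁻¹) _ p :=
    (hasDerivAt_inv h).comp_hasFDerivAt p h1
  have h3 : HasFDerivAt (fun q : TSpace n => q.1 i) _ p :=
    ((ContinuousLinearMap.proj (R := ℝ) (φ := fun _ : Fin n => ℝ) i).comp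
      (ContinuousLinearMap.fst ℝ (Fin n → ℝ) (Fin n → ℝ))).hasFDerivAt
  have h5 : HasFDerivAt (fun q : TSpace n => ℓ q.2) _ p :=
    (ℓ.comp (ContinuousLinearMap.snd ℝ (Fin n → ℝ) (Fin n → ℝ))).hasFDerivAt
  have h6 : HasFDerivAt (modelField ℓ x₀ i) _ p := (h2.mul (hasFDerivAt_coord p i)).add
    ((h2.pow 2).mul ((h3.sub_const (x₀ i)).mul h5))
  rw [h6.fderiv]
  simp
  ring

theorem fderiv_modelField_vertical (h : affineDenom ℓ x₀ p.1 ≠ 0) (i : Fin n) (a : Fin n → ℝ) :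
    fderiv ℝ (modelField ℓ x₀ i) p (0, a) = modelField ℓ x₀ i (p.1, a) := by
  rw [fderiv_modelField h, modelField]
  simp

/-- The law satisfied by `σ₀`, now with `P = ℓ y / B`; squaring and summing yields the law for the
metric. -/
theorem fderiv_modelField_horizontal (h : affineDenom ℓ x₀ p.1 ≠ 0) (i : Fin n)
    (a : Fin n → ℝ) : fderiv ℝ (modelField ℓ x₀ i) p (a, 0) =
      (affineDenom ℓ x₀ p.1)⁻¹ * ℓ p.2 * fderiv ℝ (modelField ℓ x₀ i) p (0, a) +
        (affineDenom ℓ x₀ p.1)⁻¹ * ℓ a * modelField ℓ x₀ i p := by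
  rw [fderiv_modelField h, fderiv_modelField h, modelField]
  simp
  ring

theorem fderiv_modelMetric (h : affineDenom ℓ x₀ p.1 ≠ 0) (b : TSpace n) :
    fderiv ℝ (modelMetric ℓ x₀) p b =
      ∑ i, 2 * (modelField ℓ x₀ i p * fderiv ℝ (modelField ℓ x₀ i) p b) := by
  have h1 : HasFDerivAt (modelMetric ℓ x₀) _ p := HasFDerivAt.fun_sum fun i _ =>
    (differentiableAt_of_smooth (contDiffAt_modelField h i)).hasFDerivAt.pow 2
  rw [h1.fderiv]
  simp [mul_assoc]

theorem fderiv_modelMetric_horizontal (h : affineDenom ℓ x₀ p.1 ≠ 0) (a : Fin n → ℝ) :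
    fderiv ℝ (modelMetric ℓ x₀) p (a, 0) =
      (affineDenom ℓ x₀ p.1)⁻¹ * ℓ p.2 * fderiv ℝ (modelMetric ℓ x₀) p (0, a) +
        2 * ((affineDenom ℓ x₀ p.1)⁻¹ * ℓ a) * modelMetric ℓ x₀ p := by
  rw [fderiv_modelMetric h, fderiv_modelMetric h, modelMetric, Finset.mul_sum, Finset.mul_sum,
    ← Finset.sum_add_distrib]
  refine Finset.sum_congr rfl fun i _ => ?_
  rw [fderiv_modelField_horizontal h]
  ring

theorem modelField_smul (x : Fin n → ℝ) (i : Fin n) (y : Fin n → ℝ) (t : ℝ) :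
    modelField ℓ x₀ i (x, t • y) = t * modelField ℓ x₀ i (x, y) := by
  simp [modelField]
  ring

theorem modelMetric_smul (x y : Fin n → ℝ) (t : ℝ) :
    modelMetric ℓ x₀ (x, t • y) = t ^ 2 * modelMetric ℓ x₀ (x, y) := by
  simp only [modelMetric, modelField_smul, mul_pow, Finset.mul_sum]

/-- Applying `ℓ` to `B y = -ℓ(y) (x - x₀)` and using `B = 1 - ℓ (x - x₀)` gives `ℓ(y) = 0`, hence `B
y = 0`. -/
theorem eq_zero_of_modelField_eq_zero {x y : Fin n → ℝ} (h : affineDenom ℓ x₀ x ≠ 0)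
    (h0 : ∀ i, modelField ℓ x₀ i (x, y) = 0) : y = 0 := by
  have h1 : affineDenom ℓ x₀ x • y = -(ℓ y • (x - x₀)) := by
    funext i
    have := h0 i
    simp only [modelField] at this
    field_simp at this
    simp only [Pi.smul_apply, Pi.neg_apply, Pi.sub_apply, smul_eq_mul]
    linarith
  have h2 := congrArg ℓ h1
  simp only [map_smul, map_neg, smul_eq_mul] at h2
  have h3 : ℓ y = 0 := by
    have : affineDenom ℓ x₀ x = 1 - ℓ (x - x₀) := rfl
    rw [this] at h2
    linarith
  rw [h3, zero_smul, neg_zero] at h1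
  exact (smul_eq_zero.1 h1).resolve_left h

/-- The velocity is linear in `y`, say `M y`, so `L = |M y|²` and `g = Mᵀ M`; non-degeneracy reduces
to injectivity of `M`. -/
theorem fundamentalTensor_modelMetric (h : affineDenom ℓ x₀ p.1 ≠ 0) :
    fundamentalTensor (modelMetric ℓ x₀) p =
      (Matrix.of fun m i => modelField ℓ x₀ m (p.1, Pi.single i 1)).transpose *
        Matrix.of fun m i => modelField ℓ x₀ m (p.1, Pi.single i 1) := by
  have hs := contDiffAt_modelMetric h
  have hnear : ∀ᶠ q : TSpace n in 𝓝 p, affineDenom ℓ x₀ q.1 ≠ 0 :=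
    ContinuousAt.eventually_ne
      ((hasFDerivAt_affineDenom ℓ x₀ p.1).continuousAt.comp (f := Prod.fst) continuousAt_fst) h
  ext i j
  have he : (fun q => fderiv ℝ (modelMetric ℓ x₀) q (0, Pi.single i 1)) =ᶠ[𝓝 p] fun q =>
      ∑ m, 2 * (modelField ℓ x₀ m q * modelField ℓ x₀ m (q.1, Pi.single i 1)) := by
    filter_upwards [hnear] with q hq
    rw [fderiv_modelMetric hq]
    exact Finset.sum_congr rfl fun m _ => by rw [fderiv_modelField_vertical hq]
  have hcomp : ∀ m, HasFDerivAt (fun q : TSpace n => modelField ℓ x₀ m (q.1, Pi.single i 1))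
      _ p := fun m =>
    (differentiableAt_of_smooth (contDiffAt_modelField (p := (p.1, Pi.single i 1))
      h m)).hasFDerivAt.comp p (f := fun q : TSpace n => ((q.1, Pi.single i 1) : TSpace n))
        (hasFDerivAt_fst.prodMk (hasFDerivAt_const _ _))
  have h2 : HasFDerivAt (fun q =>
      ∑ m, 2 * (modelField ℓ x₀ m q * modelField ℓ x₀ m (q.1, Pi.single i 1))) _ p :=
    HasFDerivAt.fun_sum fun m _ =>
      ((differentiableAt_of_smooth (contDiffAt_modelField h m)).hasFDerivAt.mul
        (hcomp m)).const_mul 2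
  rw [fundamentalTensor_apply hs, ← fderiv_fderiv_apply_const hs, he.fderiv_eq, h2.fderiv,
    Matrix.mul_apply]
  simp [fderiv_modelField_vertical h, Finset.sum_div]
  refine Finset.sum_congr rfl fun m _ => ?_
  rw [Prod.mk_zero_zero, map_zero]
  ring

theorem det_fundamentalTensor_modelMetric (h : affineDenom ℓ x₀ p.1 ≠ 0) :
    (fundamentalTensor (modelMetric ℓ x₀) p).det ≠ 0 := by
  rw [fundamentalTensor_modelMetric h, Matrix.det_mul, Matrix.det_transpose]
  refine mul_self_ne_zero.2 fun h0 => ?_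
  obtain ⟨w, hw, hw0⟩ := Matrix.exists_mulVec_eq_zero_iff.2 h0
  refine hw (eq_zero_of_modelField_eq_zero h fun m => ?_)
  refine Eq.trans ?_ (congrFun hw0 m)
  rw [← fderiv_modelField_vertical (p := (p.1, w)) h, apply_inr_eq_sum]
  refine Finset.sum_congr rfl fun i _ => ?_
  rw [fderiv_modelField_vertical (p := (p.1, w)) h]
  rfl

end Model

/-! ### Gluing the model metrics over the components of `U` -/

section Metrization

variable {n : ℕ} {U : Set (Fin n → ℝ)} {σ : (Fin n → ℝ) → ℝ} {C : Set (TSpace n)}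

/-- A point of the connected component of `x` in `U`, depending only on the component. -/
def componentPoint (U : Set (Fin n → ℝ)) (x : Fin n → ℝ) : Fin n → ℝ :=
  Classical.epsilon (· ∈ connectedComponentIn U x)

theorem componentPoint_mem {x : Fin n → ℝ} (hx : x ∈ U) :
    componentPoint U x ∈ connectedComponentIn U x :=
  Classical.epsilon_spec (p := (· ∈ connectedComponentIn U x)) ⟨x, mem_connectedComponentIn hx⟩

theorem componentPoint_eq {x z : Fin n → ℝ} (hz : z ∈ connectedComponentIn U x) :
    componentPoint U z = componentPoint U x := by
  rw [componentPoint, componentPoint, connectedComponentIn_eq hz]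

theorem fundamentalTensor_congr {L L' : TSpace n → ℝ} {p : TSpace n} (h : L =ᶠ[𝓝 p] L') :
    fundamentalTensor L p = fundamentalTensor L' p := by
  ext i j
  simp only [fundamentalTensor, Matrix.of_apply, pdy]
  congr 1
  refine Filter.EventuallyEq.fderiv_eq ?_
  have h2 : (fun q => L q / 2) =ᶠ[𝓝 p] fun q => L' q / 2 := h.fun_comp (· / 2)
  filter_upwards [h2.fderiv (𝕜 := ℝ)] with q hq
  exact congrArg (fun T : TSpace n →L[ℝ] ℝ => T (0, Pi.single i 1)) hq

/-- The flat metric of `modelMetric` on each component of `U` induces the spray on all of `C`. -/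
theorem isInducedOn_sigmaSpray (hU : IsOpen U) (hσ : ContDiffOn ℝ ∞ σ U)
    (hC : IsConicalRegion U C) (h0 : ∀ p ∈ C, sigma1 σ p ≠ 0)
    (h5 : ∀ x ∈ U, ∀ y, 3 * sigma2 σ (x, y) ^ 2 = 2 * sigma1 σ (x, y) * sigma3 σ (x, y)) :
    IsInducedOn C (sigmaSpray σ) := by
  have hσ0 : ∀ x ∈ U, ∃ y, sigma1 σ (x, y) ≠ 0 := fun x hx =>
    (hC.fibre_nonempty x hx).imp fun y hy => h0 _ hy
  -- The base point is constant on each component, and components of the open set `U` are open, so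
  -- `L` agrees near every point of `C` with a single model metric.
  set L : TSpace n → ℝ := fun p =>
    modelMetric (projForm σ (componentPoint U p.1)) (componentPoint U p.1) p with hLdef
  have hB : ∀ x ∈ U, affineDenom (projForm σ (componentPoint U x)) (componentPoint U x) x •
      projForm σ x = projForm σ (componentPoint U x) ∧
      affineDenom (projForm σ (componentPoint U x)) (componentPoint U x) x ≠ 0 := fun x hx =>
    affineDenom_smul_eq hU (fun z hz => differentiableAt_projForm hU hσ hz (hσ0 z hz))
      (fun z hz => fderiv_projForm hU hσ hσ0 h5 hz) isPreconnected_connectedComponentIn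
      (connectedComponentIn_subset U x) (componentPoint_mem hx) (mem_connectedComponentIn hx)
  have hloc : ∀ p ∈ C, L =ᶠ[𝓝 p]
      modelMetric (projForm σ (componentPoint U p.1)) (componentPoint U p.1) := by
    intro p hp
    filter_upwards [continuousAt_fst.preimage_mem_nhds (hU.connectedComponentIn.mem_nhds
      (mem_connectedComponentIn (hC.base_mem p hp)))] with q hq
    simp only [hLdef]
    rw [componentPoint_eq hq]
  have hL : IsFinslerMetricOn C L := by
    refine ⟨fun p hp => ?_, fun p _ t _ => modelMetric_smul p.1 p.2 t, fun p hp => ?_⟩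
    · exact ((contDiffAt_modelMetric (hB p.1 (hC.base_mem p hp)).2).congr_of_eventuallyEq
        (hloc p hp)).contDiffWithinAt
    · rw [fundamentalTensor_congr (hloc p hp)]
      exact det_fundamentalTensor_modelMetric (hB p.1 (hC.base_mem p hp)).2
  refine ⟨L, hL, (forall_projective_eq_inducedSpray_iff hC.isOpen hL
    (fun p hp => differentiableAt_of_smooth
      (contDiffAt_projFactor hU hσ (hC.base_mem p hp) (h0 p hp)))
    (fun p hp => fderiv_projFactor_euler hU hσ (hC.base_mem p hp) (h0 p hp))).2 fun p hp a => ?_⟩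
  obtain ⟨hB1, hB2⟩ := hB p.1 (hC.base_mem p hp)
  have hθ : ∀ a, (affineDenom (projForm σ (componentPoint U p.1)) (componentPoint U p.1) p.1)⁻¹ *
      projForm σ (componentPoint U p.1) a = projForm σ p.1 a := by
    intro a
    have h := congrArg (fun ℓ : (Fin n → ℝ) →L[ℝ] ℝ => ℓ a) hB1
    simp only [smul_apply, smul_eq_mul] at h
    rw [← h, inv_mul_cancel_left₀ hB2]
  rw [(hloc p hp).fderiv_eq, (hloc p hp).self_of_nhds, fderiv_modelMetric_horizontal hB2, hθ, hθ,
    (fderiv_projFactor_horizontal hU hσ hσ0 h5 hC h0 hp a).1,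
    projFactor_eq hU hσ hσ0 h5 (hC.base_mem p hp) (h0 p hp)]

end Metrization

end SprayGeometry

end

/-! ### The equivalences -/

theorem mainTheorem9 (n : ℕ) (hn : 2 ≤ n) (U : Set (Fin n → ℝ)) (hU : IsOpen U)
    (σ : (Fin n → ℝ) → ℝ) (hσ : ContDiffOn ℝ ∞ σ U)
    (C : Set (SprayGeometry.TSpace n)) (hC : SprayGeometry.IsConicalRegion U C)
    (hσ0 : ∀ p ∈ C, SprayGeometry.sigma1 σ p ≠ 0) :
    SprayGeometry.IsSprayOn C (SprayGeometry.sigmaSpray σ) ∧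
    List.TFAE [
      SprayGeometry.IsInducedOn C (SprayGeometry.sigmaSpray σ),
      SprayGeometry.IsMetrizable U C (SprayGeometry.sigmaSpray σ),
      SprayGeometry.IsLocallyMetrizable U C (SprayGeometry.sigmaSpray σ),
      SprayGeometry.IsOfZeroScalarCurvature C (SprayGeometry.sigmaSpray σ),
      ∀ x ∈ U, ∀ y : Fin n → ℝ,
        3 * (SprayGeometry.sigma2 σ (x, y)) ^ 2 =
          2 * SprayGeometry.sigma1 σ (x, y) * SprayGeometry.sigma3 σ (x, y)] := by
  refine ⟨SprayGeometry.isSprayOn_sigmaSpray hU hσ hC hσ0, ?_⟩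
  have hne : ∀ x ∈ U, ∃ y, SprayGeometry.sigma1 σ (x, y) ≠ 0 := fun x hx =>
    (hC.fibre_nonempty x hx).imp fun y hy => hσ0 _ hy
  tfae_have 1 → 2 := fun h => ⟨C, subset_rfl, hC, h⟩
  tfae_have 2 → 3 := fun h x hx => ⟨U, subset_rfl, hU, hx, h⟩
  -- The obstruction is pointwise in `x` and needs the metric only on some open cone over a
  -- neighbourhood of `x`, so local metrizability suffices.
  tfae_have 3 → 5 := by
    intro h x hx
    obtain ⟨V, hVU, -, hxV, C', hC'C, hC', hI⟩ := h x hx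
    have hCU : ∀ p ∈ C', p.1 ∈ U := fun p hp => hVU (hC'.base_mem p hp)
    have h0 : ∀ p ∈ C', SprayGeometry.sigma1 σ p ≠ 0 := fun p hp => hσ0 p (hC'C hp)
    exact SprayGeometry.sigma_condition_extend hC'.isOpen (hC'.fibre_nonempty x hxV) fun p hp =>
      (SprayGeometry.sigma_condition_iff hU hσ (hCU p hp) (h0 p hp)).2
        (SprayGeometry.fderiv_projFactor_of_induced hn hU hσ hC'.isOpen hCU h0 hI p hp)
  tfae_have 5 → 1 := SprayGeometry.isInducedOn_sigmaSpray hU hσ hC hσ0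
  tfae_have 5 → 4 := fun h5 =>
    SprayGeometry.zeroScalarCurvature_of_fderiv_projFactor hU hσ hC hσ0 fun p hp a =>
      (SprayGeometry.fderiv_projFactor_horizontal hU hσ hne h5 hC hσ0 hp a).2
  tfae_have 4 → 5 := by
    intro h x hx
    exact SprayGeometry.sigma_condition_extend hC.isOpen (hC.fibre_nonempty x hx) fun p hp =>
      (SprayGeometry.sigma_condition_iff hU hσ (hC.base_mem p hp) (hσ0 p hp)).2
        (SprayGeometry.fderiv_projFactor_of_zeroScalarCurvature hn hU hσ hC hσ0 h p hp)
  tfae_finish
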